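/- **Setting.** Let $I\ge 1$, $\mu,\sigma,h,r\in(0,\infty)^I$, $m\in\mathbb R^I$, $\alpha>0$, and let $\mathcal X\subset\mathbb R_+^I$ be bounded, closed and convex with nonempty interior and $0\in\mathcal X$. Put $\theta_i=1/\mu_i$, $\bar m=\theta\cdot m$, $\bar\sigma=(\sum_i\theta_i^2\sigma_i^2)^{1/2}$, $\mathbf x=\max\{\theta\cdot\xi:\xi\in\mathcal X\}$, $\bar h(w)=\min\{h\cdot\xi:\xi\in\mathcal X,\ \theta\cdot\xi=w\}$ for $w\in[0,\mathbf x]$, and $\bar r=\min\{r\cdot z:z\in\mathbb R_+^I,\ \theta\cdot z=1\}$. An $(m,\sigma)$-BM is a Brownian motion in $\mathbb R^I$ started at $0$ with drift $m$ and diffusion matrix $\mathrm{diag}(\sigma_i)$; similarly in one dimension. RCLL means right-continuous with finite left limits. Pathwise properties are understood almost surely. *BCP.* An admissible control for $x_0\in\mathcal X$ consists of a filtered probability space $(\Omega,\mathcal F,\{\mathcal F_t\}_{t\ge0},P)$ and $\{\mathcal F_t\}$-adapted processes $W,Y,Z$ with values in $\mathbb R^I$ such that: $W$ is an $(m,\sigma)$-BM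 and $W(t)-W(s)$ is independent of $\mathcal F_s$ for $0\le s<t$; $Y$ and $Z$ are RCLL; $\theta\cdot Y$ and all $Z_i$ are nonnegative and nondecreasing; and $X=x_0+W+Y-Z$ satisfies $X(t)\in\mathcal X$ for all $t$. Its cost is $$J(x_0,Y,Z)=E\int_{[0,\infty)}e^{-\alpha t}\,[h\cdot X(t)\,dt+r\cdot dZ(t)]\in[0,\infty],\qquad Z(0-)=0,$$ and $V(x_0)$ is the infimum of $J$ over all admissible controls for $x_0$ (on all filtered probability spaces). A *relaxed* control is defined in the same way, except that RCLL paths are required of $\theta\cdot Y$ and $Z$ only, not of $Y$. *RBCP.* An admissible control for $\bar x_0\in[0,\mathbf x]$ consists of a filtered probability space and adapted real processes $\bar W,\bar Y,\bar Z$ such that: $\bar W$ is an $(\bar m,\bar\sigma)$-BM and $\bar W(t)-\bar W(s)$ is independent of $\mathcal F_s$ for $0\le s<t$; $\bar Y,\bar Z$ are RCLL, nonnegative and nondecreasing; and $\bar X=\bar x_0+\bar W+\bar Y-\bar Z$ satisfies $\bar X(t)\in[0,\mathbf x]$ for all $t$. Its cost is $$\bar J(\bar x_0,\bar Y,\bar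 Z)=E\int_{[0,\infty)}e^{-\alpha t}\,[\bar h(\bar X(t))\,dt+\bar r\,d\bar Z(t)],\qquad \bar Z(0-)=0,$$ with infimum $\bar V(\bar x_0)$. **Proposition.** Let $x_0\in\mathcal X$ and $\bar x_0=\theta\cdot x_0$. (i) If $(W,Y,Z)$ is an admissible BCP control for $x_0$ on some filtered probability space, with state process $X$, then $(\bar W,\bar Y,\bar Z)=(\theta\cdot W,\theta\cdot Y,\theta\cdot Z)$ is, on the same filtered space, an admissible RBCP control for $\bar x_0$ with state process $\bar X=\theta\cdot X$, and $\bar J(\bar x_0,\bar Y,\bar Z)\le J(x_0,Y,Z)$. (ii) Let $\gamma:[0,\mathbf x]\to\mathcal X$ be Borel with $\gamma(w)\in\arg\min\{h\cdot\xi:\xi\in\mathcal X,\ \theta\cdot\xi=w\}$ for all $w\in[0,\mathbf x]$, and let $i^*$ be such that $\zeta^*=\mu_{i^*}e^{(i^*)}\in\arg\min\{r\cdot z:z\in\mathbb R_+^I,\ \theta\cdot z=1\}$. Let $(\bar W,\bar Y,\bar Z)$ be an admissible RBCP control for $\bar x_0$, with state process $\bar X$, and let $W$ be an $(m,\sigma)$-BM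 on the same space, adapted to $\{\mathcal F_t\}$, with $\theta\cdot W=\bar W$ and $W(t)-W(s)$ independent of $\mathcal F_s$ for $0\le s<t$. Put $$X(t)=\gamma(\bar X(t)),\qquad Z(t)=\zeta^*\bar Z(t),\qquad Y(t)=X(t)-x_0-W(t)+Z(t).$$ Then $(W,Y,Z)$ is a relaxed BCP control for $x_0$ and $J(x_0,Y,Z)=\bar J(\bar x_0,\bar Y,\bar Z)$. It is an admissible BCP control for $x_0$ if and only if $\gamma(\bar X(\cdot))$ has RCLL paths almost surely; in particular, it is admissible whenever $\gamma$ is continuous on $[0,\mathbf x]$. (iii) $V(x_0)=\bar V(\bar x_0)$. -/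

import Mathlib

open MeasureTheory ProbabilityTheory Set Filter
open scoped NNReal ENNReal Topology

universe u

/-- `f` is right-continuous on `[0, ∞)` and has finite left limits on `(0, ∞)`. (At `t = 0` the
filter `𝓝[<] 0` on `ℝ≥0` is trivial, so the left-limit clause says nothing there.) -/
def IsRCLL {E : Type*} [TopologicalSpace E] (f : ℝ≥0 → E) : Prop :=
  ∀ t, ContinuousWithinAt f (Ici t) t ∧ ∃ l, Tendsto f (𝓝[<] t) (𝓝 l)

/-- `W` is an `I`-dimensional `(m, σ)`-Brownian motion started at zero: drift vector `m`,
diffusion matrix `diag σ`. -/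
structure IsVecBM {I : ℕ} (m σ : Fin I → ℝ) {Ω : Type*} [MeasurableSpace Ω] (P : Measure Ω)
    (W : ℝ≥0 → Ω → Fin I → ℝ) : Prop where
  zero : ∀ᵐ ω ∂P, W 0 ω = 0
  cont : ∀ᵐ ω ∂P, Continuous fun t => W t ω
  indep : HasIndepIncrements W P
  law : ∀ s t : ℝ≥0, s ≤ t → HasLaw (fun ω => W t ω - W s ω)
    (Measure.pi fun i => gaussianReal (m i * ((t : ℝ) - s)) ((σ i ^ 2).toNNReal * (t - s))) P

/-- `W` is a one-dimensional `(m, σ)`-Brownian motion started at zero. -/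
structure IsRealBM (m σ : ℝ) {Ω : Type*} [MeasurableSpace Ω] (P : Measure Ω)
    (W : ℝ≥0 → Ω → ℝ) : Prop where
  zero : ∀ᵐ ω ∂P, W 0 ω = 0
  cont : ∀ᵐ ω ∂P, Continuous fun t => W t ω
  indep : HasIndepIncrements W P
  law : ∀ s t : ℝ≥0, s ≤ t → HasLaw (fun ω => W t ω - W s ω)
    (gaussianReal (m * ((t : ℝ) - s)) ((σ ^ 2).toNNReal * (t - s))) P

/-- The path `z` on `[0, ∞)` extended by `0` to negative times (the convention `z(0-) = 0`). -/
noncomputable def extPath (z : ℝ≥0 → ℝ) (t : ℝ) : ℝ := if t < 0 then 0 else z t.toNNReal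

open Classical in
/-- The Lebesgue--Stieltjes measure `dz` on `[0, ∞)` of a nonnegative nondecreasing RCLL path `z`,
where `z(0) > 0` counts as an atom at time `0` (junk value `0` for other paths). -/
noncomputable def pathMeasure (z : ℝ≥0 → ℝ) : Measure ℝ :=
  if hz : Monotone (extPath z) then hz.stieltjesFunction.measure else 0

/-- `∫_{[0,∞)} e^{-αt} dz(t)`. -/
noncomputable def discountedVariation (α : ℝ) (z : ℝ≥0 → ℝ) : ℝ≥0∞ :=
  ∫⁻ t in Ici (0 : ℝ), ENNReal.ofReal (Real.exp (-α * t)) ∂(pathMeasure z)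

/-- `∫_0^∞ e^{-αt} f(t) dt` for a nonnegative function `f` on `[0, ∞)`. -/
noncomputable def discountedIntegral (α : ℝ) (f : ℝ≥0 → ℝ) : ℝ≥0∞ :=
  ∫⁻ t in Ici (0 : ℝ), ENNReal.ofReal (Real.exp (-α * t) * f t.toNNReal)

/-- The data of the Brownian control problem with `I ≥ 1` classes. -/
structure BCPData (I : ℕ) where
  one_le : 1 ≤ I
  /-- service rates -/
  μ : Fin I → ℝ
  μ_pos : ∀ i, 0 < μ i
  /-- drift vector -/
  m : Fin I → ℝ
  /-- diffusion coefficients -/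
  σ : Fin I → ℝ
  σ_pos : ∀ i, 0 < σ i
  /-- discount rate -/
  α : ℝ
  α_pos : 0 < α
  /-- holding costs -/
  h : Fin I → ℝ
  h_pos : ∀ i, 0 < h i
  /-- rejection costs -/
  r : Fin I → ℝ
  r_pos : ∀ i, 0 < r i
  /-- state space -/
  dom : Set (Fin I → ℝ)
  dom_nonneg : ∀ ξ ∈ dom, 0 ≤ ξ
  dom_bounded : Bornology.IsBounded dom
  dom_closed : IsClosed dom
  dom_convex : Convex ℝ dom
  dom_interior : (interior dom).Nonempty
  zero_mem : (0 : Fin I → ℝ) ∈ dom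

namespace BCPData

variable {I : ℕ} (D : BCPData I)

/-- Workload vector `θ_i = 1 / μ_i`. -/
noncomputable def θ : Fin I → ℝ := fun i => 1 / D.μ i

/-- `m̄ = θ · m`. -/
noncomputable def mBar : ℝ := D.θ ⬝ᵥ D.m

/-- `σ̄ = (∑ θ_i² σ_i²)^{1/2}`. -/
noncomputable def σBar : ℝ := √(∑ i, D.θ i ^ 2 * D.σ i ^ 2)

/-- The maximal workload `max {θ · ξ : ξ ∈ dom}`. -/
noncomputable def xMax : ℝ := sSup ((fun ξ => D.θ ⬝ᵥ ξ) '' D.dom)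

/-- States with workload `w`. -/
def fiber (w : ℝ) : Set (Fin I → ℝ) := {ξ | ξ ∈ D.dom ∧ D.θ ⬝ᵥ ξ = w}

/-- `{z ∈ ℝ₊^I : θ · z = 1}`. -/
def unitRej : Set (Fin I → ℝ) := {z | 0 ≤ z ∧ D.θ ⬝ᵥ z = 1}

/-- `h̄(w) = min {h · ξ : ξ ∈ dom, θ · ξ = w}` (for `w ∈ [0, xMax]`). -/
noncomputable def hBar (w : ℝ) : ℝ := sInf ((fun ξ => D.h ⬝ᵥ ξ) '' D.fiber w)

/-- `r̄ = min {r · z : z ∈ ℝ₊^I, θ · z = 1}`. -/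
noncomputable def rBar : ℝ := sInf ((fun z => D.r ⬝ᵥ z) '' D.unitRej)

/-- `γ` restricted to `[0, xMax]` is a Borel minimizing curve. Its values elsewhere play no role
except on a null set, where they keep `γ` Borel. -/
structure IsMinimizingCurve (γ : ℝ → Fin I → ℝ) : Prop where
  measurable : Measurable γ
  mem : ∀ w ∈ Icc 0 D.xMax, γ w ∈ D.fiber w
  isMin : ∀ w ∈ Icc 0 D.xMax, IsMinOn (fun ξ => D.h ⬝ᵥ ξ) (D.fiber w) (γ w)

/-- `ζ* = μ_{i*} e^{(i*)}`. -/
noncomputable def ζ (istar : Fin I) : Fin I → ℝ := Pi.single istar (D.μ istar)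

/-- `ζ*` is in the argmin of `r · z` over `z ∈ ℝ₊^I`, `θ · z = 1`. -/
def IsCheapestClass (istar : Fin I) : Prop :=
  D.ζ istar ∈ D.unitRej ∧ IsMinOn (fun z => D.r ⬝ᵥ z) D.unitRej (D.ζ istar)

/-- `X(t) = x₀ + W(t) + Y(t) - Z(t)`. -/
def state (x₀ : Fin I → ℝ) {Ω : Type*} (W Y Z : ℝ≥0 → Ω → Fin I → ℝ) :
    ℝ≥0 → Ω → Fin I → ℝ :=
  fun t ω => x₀ + W t ω + Y t ω - Z t ω

/-- `X̄(t) = x̄₀ + W̄(t) + Ȳ(t) - Z̄(t)`. -/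
def redState (w₀ : ℝ) {Ω : Type*} (W Y Z : ℝ≥0 → Ω → ℝ) : ℝ≥0 → Ω → ℝ :=
  fun t ω => w₀ + W t ω + Y t ω - Z t ω

/-- The process `θ · U`. -/
noncomputable def proj {Ω : Type*} (U : ℝ≥0 → Ω → Fin I → ℝ) : ℝ≥0 → Ω → ℝ :=
  fun t ω => D.θ ⬝ᵥ U t ω

/-- All requirements on a control of the `I`-dimensional problem from `x₀`, except that the RCLL
property is asked of `Z` and of the workload component `θ · Y` only. Pathwise properties are
almost sure. -/
structure IsRelaxedControl (x₀ : Fin I → ℝ) {Ω : Type*} {mΩ : MeasurableSpace Ω}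
    (P : Measure Ω) (𝓕 : Filtration ℝ≥0 mΩ) (W Y Z : ℝ≥0 → Ω → Fin I → ℝ) : Prop where
  bm : IsVecBM D.m D.σ P W
  adapted_W : Adapted 𝓕 W
  adapted_Y : Adapted 𝓕 Y
  adapted_Z : Adapted 𝓕 Z
  indep : ∀ s t : ℝ≥0, s < t →
    Indep (MeasurableSpace.comap (fun ω => W t ω - W s ω) inferInstance) (𝓕 s) P
  rcll_Z : ∀ᵐ ω ∂P, IsRCLL fun t => Z t ω
  rcll_θY : ∀ᵐ ω ∂P, IsRCLL fun t => D.proj Y t ω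
  nonneg_θY : ∀ᵐ ω ∂P, ∀ t, 0 ≤ D.proj Y t ω
  mono_θY : ∀ᵐ ω ∂P, Monotone fun t => D.proj Y t ω
  nonneg_Z : ∀ᵐ ω ∂P, ∀ t, 0 ≤ Z t ω
  mono_Z : ∀ᵐ ω ∂P, ∀ i, Monotone fun t => Z t ω i
  state_mem : ∀ᵐ ω ∂P, ∀ t, state x₀ W Y Z t ω ∈ D.dom

/-- Admissible control for the `I`-dimensional problem (BCP) from `x₀`: as above, with `(Y, Z)`
RCLL. -/
structure IsAdmissible (x₀ : Fin I → ℝ) {Ω : Type*} {mΩ : MeasurableSpace Ω}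
    (P : Measure Ω) (𝓕 : Filtration ℝ≥0 mΩ) (W Y Z : ℝ≥0 → Ω → Fin I → ℝ) : Prop
    extends D.IsRelaxedControl x₀ P 𝓕 W Y Z where
  rcll_Y : ∀ᵐ ω ∂P, IsRCLL fun t => Y t ω

/-- Admissible control for the one-dimensional reduced problem (RBCP) from `w₀`. -/
structure IsRedAdmissible (w₀ : ℝ) {Ω : Type*} {mΩ : MeasurableSpace Ω}
    (P : Measure Ω) (𝓕 : Filtration ℝ≥0 mΩ) (W Y Z : ℝ≥0 → Ω → ℝ) : Prop where
  bm : IsRealBM D.mBar D.σBar P W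
  adapted_W : Adapted 𝓕 W
  adapted_Y : Adapted 𝓕 Y
  adapted_Z : Adapted 𝓕 Z
  indep : ∀ s t : ℝ≥0, s < t →
    Indep (MeasurableSpace.comap (fun ω => W t ω - W s ω) inferInstance) (𝓕 s) P
  rcll_Y : ∀ᵐ ω ∂P, IsRCLL fun t => Y t ω
  rcll_Z : ∀ᵐ ω ∂P, IsRCLL fun t => Z t ω
  nonneg_Y : ∀ᵐ ω ∂P, ∀ t, 0 ≤ Y t ω
  nonneg_Z : ∀ᵐ ω ∂P, ∀ t, 0 ≤ Z t ω
  mono_Y : ∀ᵐ ω ∂P, Monotone fun t => Y t ω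
  mono_Z : ∀ᵐ ω ∂P, Monotone fun t => Z t ω
  state_mem : ∀ᵐ ω ∂P, ∀ t, redState w₀ W Y Z t ω ∈ Icc 0 D.xMax

/-- `J = E ∫_0^∞ e^{-αt} [h · X(t) dt + r · dZ(t)] ∈ [0, ∞]`. -/
noncomputable def cost (x₀ : Fin I → ℝ) {Ω : Type*} [MeasurableSpace Ω]
    (P : Measure Ω) (W Y Z : ℝ≥0 → Ω → Fin I → ℝ) : ℝ≥0∞ :=
  ∫⁻ ω, (discountedIntegral D.α (fun t => D.h ⬝ᵥ state x₀ W Y Z t ω)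
    + ∑ i, ENNReal.ofReal (D.r i) * discountedVariation D.α (fun t => Z t ω i)) ∂P

/-- `J̄ = E ∫_0^∞ e^{-αt} [h̄(X̄(t)) dt + r̄ dZ̄(t)] ∈ [0, ∞]`. -/
noncomputable def redCost (w₀ : ℝ) {Ω : Type*} [MeasurableSpace Ω]
    (P : Measure Ω) (W Y Z : ℝ≥0 → Ω → ℝ) : ℝ≥0∞ :=
  ∫⁻ ω, (discountedIntegral D.α (fun t => D.hBar (redState w₀ W Y Z t ω))
    + ENNReal.ofReal D.rBar * discountedVariation D.α (fun t => Z t ω)) ∂P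

/-- The value `V(x₀)`: infimum of the cost over all admissible controls, on all filtered
probability spaces. -/
noncomputable def value (x₀ : Fin I → ℝ) : ℝ≥0∞ :=
  sInf {c | ∃ (Ω : Type u) (mΩ : MeasurableSpace Ω) (P : Measure Ω) (𝓕 : Filtration ℝ≥0 mΩ)
    (W Y Z : ℝ≥0 → Ω → Fin I → ℝ), IsProbabilityMeasure P ∧
      D.IsAdmissible x₀ P 𝓕 W Y Z ∧ c = D.cost x₀ P W Y Z}

/-- The value `V̄(w₀)` of the reduced problem. -/
noncomputable def redValue (w₀ : ℝ) : ℝ≥0∞ :=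
  sInf {c | ∃ (Ω : Type u) (mΩ : MeasurableSpace Ω) (P : Measure Ω) (𝓕 : Filtration ℝ≥0 mΩ)
    (W Y Z : ℝ≥0 → Ω → ℝ), IsProbabilityMeasure P ∧
      D.IsRedAdmissible w₀ P 𝓕 W Y Z ∧ c = D.redCost w₀ P W Y Z}

/-- `Z(t) = ζ* Z̄(t)`. -/
noncomputable def liftZ (istar : Fin I) {Ω : Type*} (Zb : ℝ≥0 → Ω → ℝ) :
    ℝ≥0 → Ω → Fin I → ℝ :=
  fun t ω => Zb t ω • D.ζ istar

/-- `Y(t) = X(t) - x₀ - W(t) + Z(t)`, where `X(t) = γ(X̄(t))` and `Z(t) = ζ* Z̄(t)`. -/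
noncomputable def liftY (γ : ℝ → Fin I → ℝ) (istar : Fin I) (x₀ : Fin I → ℝ) {Ω : Type*}
    (W : ℝ≥0 → Ω → Fin I → ℝ) (Xb Zb : ℝ≥0 → Ω → ℝ) : ℝ≥0 → Ω → Fin I → ℝ :=
  fun t ω => γ (Xb t ω) - x₀ - W t ω + D.liftZ istar Zb t ω

end BCPData

/-! Projecting by `θ` can only lower the cost. Every state satisfies `h · ξ ≥ h̄(θ · ξ)`, and `r̄
θ_i ≤ r_i` because `μ_i e^(i)` competes in the minimum defining `r̄`; since `d(θ · Z) = ∑ θ_i dZ_i`,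
both parts of the cost compare path by path. Conversely, a state on the minimizing curve and
rejections along `ζ*` turn both inequalities into equalities. The lifted `Y` meets the constraints
because `θ · γ(w) = w` and `θ · ζ* = 1` give `θ · Y = Ȳ`, and no other component of `Y` is
constrained; only its RCLL property depends on `γ`.

Projection gives `V̄ ≤ V`. The reverse inequality meets two obstacles. The minimizing curve may
jump, so `γ(X̄)` may fail to be RCLL. `exists_continuous_selection` replaces it by a continuous
`ε`-optimal curve, glued from local sections by convexity of the fibers and lower semicontinuity of
`h̄`; the loss is at most `ε / α`. The space of a reduced control may carry no `I`-dimensional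
Brownian motion with workload `W̄`. The control is moved to the power `Fin (I + 1) → Ω`, where it
runs on coordinate `0`. The other coordinates supply `I` independent Brownian motions, and
`gaussianSwap` replaces their component along the workload direction by copy `0`. The power stays in
the universe of `Ω`, and Brownian motion never has to be constructed. -/

@[fun_prop]
theorem continuous_dotProduct_left {n : ℕ} (u : Fin n → ℝ) :
    Continuous fun ξ : Fin n → ℝ => u ⬝ᵥ ξ := by
  unfold dotProduct
  fun_prop

/-! ### Convex geometry of the workload map and the two static minimizations. -/

namespace BCPData

variable {I : ℕ} (D : BCPData I)

theorem θ_pos (i : Fin I) : 0 < D.θ i := one_div_pos.2 (D.μ_pos i)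

theorem θ_mul_μ (i : Fin I) : D.θ i * D.μ i = 1 := one_div_mul_cancel (D.μ_pos i).ne'

theorem σBar_sq : D.σBar ^ 2 = ∑ i, D.θ i ^ 2 * D.σ i ^ 2 :=
  Real.sq_sqrt (Finset.sum_nonneg fun _ _ => by positivity)

theorem σBar_pos : 0 < D.σBar := by
  have : Nonempty (Fin I) := ⟨⟨0, D.one_le⟩⟩
  exact Real.sqrt_pos.2 (Finset.sum_pos (fun i _ => mul_pos (pow_pos (D.θ_pos i) 2)
    (pow_pos (D.σ_pos i) 2)) Finset.univ_nonempty)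

theorem isCompact_dom : IsCompact D.dom :=
  Metric.isCompact_of_isClosed_isBounded D.dom_closed D.dom_bounded

theorem isCompact_image_θ : IsCompact ((fun ξ => D.θ ⬝ᵥ ξ) '' D.dom) :=
  D.isCompact_dom.image (by fun_prop)

theorem θ_dotProduct_mem_Icc {ξ : Fin I → ℝ} (hξ : ξ ∈ D.dom) : D.θ ⬝ᵥ ξ ∈ Icc 0 D.xMax :=
  ⟨dotProduct_nonneg_of_nonneg (fun i => (D.θ_pos i).le) (D.dom_nonneg ξ hξ),
    le_csSup D.isCompact_image_θ.bddAbove (mem_image_of_mem _ hξ)⟩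

theorem exists_mem_dom_eq_xMax : ∃ ξ ∈ D.dom, D.θ ⬝ᵥ ξ = D.xMax :=
  D.isCompact_image_θ.sSup_mem ⟨_, mem_image_of_mem _ D.zero_mem⟩

theorem xMax_nonneg : 0 ≤ D.xMax := by
  obtain ⟨ξ, hξ, h⟩ := D.exists_mem_dom_eq_xMax
  exact h ▸ (D.θ_dotProduct_mem_Icc hξ).1

theorem h_dotProduct_nonneg {ξ : Fin I → ℝ} (hξ : ξ ∈ D.dom) : 0 ≤ D.h ⬝ᵥ ξ :=
  dotProduct_nonneg_of_nonneg (fun i => (D.h_pos i).le) (D.dom_nonneg ξ hξ)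

theorem isCompact_fiber (w : ℝ) : IsCompact (D.fiber w) :=
  D.isCompact_dom.inter_right
    (isClosed_singleton.preimage (continuous_dotProduct_left D.θ) : IsClosed {ξ | D.θ ⬝ᵥ ξ = w})

theorem convex_fiber (w : ℝ) : Convex ℝ (D.fiber w) := by
  intro x hx y hy a b ha hb hab
  refine ⟨D.dom_convex hx.1 hy.1 ha hb hab, ?_⟩
  rw [dotProduct_add, dotProduct_smul, dotProduct_smul, hx.2, hy.2, ← add_smul, hab, one_smul]

theorem fiber_nonempty {w : ℝ} (hw : w ∈ Icc 0 D.xMax) : (D.fiber w).Nonempty := by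
  obtain ⟨ξ, hξ, h⟩ := D.exists_mem_dom_eq_xMax
  have hc : OrdConnected ((fun ξ => D.θ ⬝ᵥ ξ) '' D.dom) :=
    (D.dom_convex.isPreconnected.image _ (by fun_prop)).ordConnected
  obtain ⟨η, hη, h'⟩ := hc.out ⟨0, D.zero_mem, dotProduct_zero _⟩ ⟨ξ, hξ, h⟩ hw
  exact ⟨η, hη, h'⟩

theorem bddBelow_image_h_fiber (w : ℝ) : BddBelow ((fun ξ => D.h ⬝ᵥ ξ) '' D.fiber w) :=
  ⟨0, by rintro _ ⟨ξ, hξ, rfl⟩; exact D.h_dotProduct_nonneg hξ.1⟩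

theorem hBar_le {w : ℝ} {ξ : Fin I → ℝ} (hξ : ξ ∈ D.fiber w) : D.hBar w ≤ D.h ⬝ᵥ ξ :=
  csInf_le (D.bddBelow_image_h_fiber w) (mem_image_of_mem _ hξ)

theorem exists_mem_fiber_eq_hBar {w : ℝ} (hw : w ∈ Icc 0 D.xMax) :
    ∃ ξ ∈ D.fiber w, D.h ⬝ᵥ ξ = D.hBar w :=
  ((D.isCompact_fiber w).image (continuous_dotProduct_left D.h)).sInf_mem
    ((D.fiber_nonempty hw).image _)

theorem hBar_eq_of_isMinOn {w : ℝ} {ξ : Fin I → ℝ} (hξ : ξ ∈ D.fiber w)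
    (hmin : IsMinOn (fun ξ => D.h ⬝ᵥ ξ) (D.fiber w) ξ) : D.hBar w = D.h ⬝ᵥ ξ :=
  le_antisymm (D.hBar_le hξ) (le_csInf ⟨_, mem_image_of_mem _ hξ⟩
    (by rintro _ ⟨η, hη, rfl⟩; exact hmin hη))

/-- Sublevel sets of `h̄` on `[0, xMax]` are images of compact sets; this is lower semicontinuity. -/
theorem isClosed_hBar_sublevel (c : ℝ) : IsClosed {w | w ∈ Icc 0 D.xMax ∧ D.hBar w ≤ c} := by
  have : {w | w ∈ Icc 0 D.xMax ∧ D.hBar w ≤ c}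
      = (fun ξ => D.θ ⬝ᵥ ξ) '' (D.dom ∩ {ξ | D.h ⬝ᵥ ξ ≤ c}) := by
    ext w
    constructor
    · rintro ⟨hw, hc⟩
      obtain ⟨ξ, hξ, h⟩ := D.exists_mem_fiber_eq_hBar hw
      exact ⟨ξ, ⟨hξ.1, h.trans_le hc⟩, hξ.2⟩
    · rintro ⟨ξ, ⟨hξ, hc⟩, rfl⟩
      exact ⟨D.θ_dotProduct_mem_Icc hξ, (D.hBar_le ⟨hξ, rfl⟩).trans hc⟩
  rw [this]
  exact ((D.isCompact_dom.inter_right (isClosed_le (continuous_dotProduct_left D.h)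
    continuous_const)).image (continuous_dotProduct_left D.θ)).isClosed

/-- Through every state there is a continuous section of the workload map. -/
theorem exists_continuous_section {ξ : Fin I → ℝ} (hξ : ξ ∈ D.dom) :
    ∃ g : ℝ → Fin I → ℝ, Continuous g ∧ g (D.θ ⬝ᵥ ξ) = ξ ∧
      ∀ w ∈ Icc 0 D.xMax, g w ∈ D.fiber w := by
  obtain ⟨η, hη, hmax⟩ := D.exists_mem_dom_eq_xMax
  set v := D.θ ⬝ᵥ ξ with hv
  have hmem {s : ℝ} (h0 : 0 ≤ s) (h1 : s ≤ 1) {ζ : Fin I → ℝ} (hζ : ζ ∈ D.dom) :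
      ξ + s • (ζ - ξ) ∈ D.dom := D.dom_convex.add_smul_sub_mem hξ hζ ⟨h0, h1⟩
  -- The path is piecewise linear, from `0` through `ξ` to a point `η` of maximal workload. If `v =
  -- 0` or `v = xMax`, the division by zero is harmless: the corresponding `max` vanishes on `[0,
  -- xMax]`.
  refine ⟨fun w => ξ + (max (v - w) 0 / v) • (0 - ξ) + (max (w - v) 0 / (D.xMax - v)) • (η - ξ),
    by fun_prop, by simp, fun w hw => ?_⟩
  rcases lt_trichotomy w v with h | rfl | h
  · have hv0 : 0 < v := hw.1.trans_lt h
    have e1 : max (w - v) 0 = 0 := max_eq_right (by linarith)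
    have e2 : max (v - w) 0 = v - w := max_eq_left (by linarith)
    simp only [e1, e2, zero_div, zero_smul, add_zero]
    refine ⟨hmem (div_nonneg (by linarith) hv0.le) ((div_le_one hv0).2 (by linarith [hw.1]))
      D.zero_mem, ?_⟩
    rw [dotProduct_add, dotProduct_smul, dotProduct_sub, dotProduct_zero, ← hv, smul_eq_mul]
    field_simp
    ring
  · simpa using ⟨hξ, hv.symm⟩
  · have hv0 : 0 < D.xMax - v := by linarith [hw.2]
    have e1 : max (v - w) 0 = 0 := max_eq_right (by linarith)
    have e2 : max (w - v) 0 = w - v := max_eq_left (by linarith)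
    simp only [e1, e2, zero_div, zero_smul, add_zero]
    refine ⟨hmem (div_nonneg (by linarith) hv0.le) ((div_le_one hv0).2 (by linarith [hw.2])) hη, ?_⟩
    rw [dotProduct_add, dotProduct_smul, dotProduct_sub, hmax, ← hv, smul_eq_mul]
    field_simp
    ring

/-- There are continuous selections of the workload fibers that are optimal up to `ε`. -/
theorem exists_continuous_selection {ε : ℝ} (hε : 0 < ε) :
    ∃ γ : ℝ → Fin I → ℝ, Continuous γ ∧
      ∀ w ∈ Icc 0 D.xMax, γ w ∈ D.fiber w ∧ D.h ⬝ᵥ γ w ≤ D.hBar w + ε := by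
  let t : Icc 0 D.xMax → Set (Fin I → ℝ) := fun w =>
    D.fiber w ∩ {ξ | D.h ⬝ᵥ ξ ≤ D.hBar w + ε}
  have ht : ∀ w, Convex ℝ (t w) := fun w => (D.convex_fiber w).inter <|
    convex_halfSpace_le ⟨fun x y => dotProduct_add _ x y, fun c x => dotProduct_smul c _ x⟩ _
  -- A partition of unity reduces the claim to local selections. Near `v`, the section through a
  -- minimizer at `v` works: continuity of `h · g` costs `ε / 2`, and lower semicontinuity of `h̄`
  -- costs the other `ε / 2`.
  obtain ⟨g, hg⟩ := exists_continuous_forall_mem_convex_of_local ht (fun v => by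
    obtain ⟨ξ, hξ, hmin⟩ := D.exists_mem_fiber_eq_hBar v.2
    obtain ⟨g, hgc, hgξ, hgm⟩ := D.exists_continuous_section hξ.1
    rw [hξ.2] at hgξ
    have h1 : ∀ᶠ w : Icc 0 D.xMax in 𝓝 v, D.h ⬝ᵥ g w < D.hBar v + ε / 2 := by
      refine ContinuousAt.eventually_lt (f := fun w : Icc 0 D.xMax => D.h ⬝ᵥ g w)
        (by fun_prop) continuousAt_const ?_
      simp only [hgξ, hmin]
      linarith
    have h2 : ∀ᶠ w : Icc 0 D.xMax in 𝓝 v, D.hBar v - ε / 2 < D.hBar w := by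
      have : ∀ᶠ w in 𝓝 (v : ℝ), w ∉ {w | w ∈ Icc 0 D.xMax ∧ D.hBar w ≤ D.hBar v - ε / 2} :=
        (D.isClosed_hBar_sublevel _).isOpen_compl.eventually_mem
          (by simp only [mem_compl_iff, mem_ofPred_eq, not_and]; intro _; linarith)
      filter_upwards [continuous_subtype_val.continuousAt.eventually this] with w hw
      by_contra! hle
      exact hw ⟨w.2, hle⟩
    refine ⟨_, h1.and h2, fun w => g w, by fun_prop, fun w hw => ⟨hgm w w.2, ?_⟩⟩
    have := hw.1
    have := hw.2
    simp only [mem_ofPred_eq]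
    linarith)
  refine ⟨IccExtend D.xMax_nonneg g, by fun_prop, fun w hw => ?_⟩
  rw [IccExtend_of_mem _ _ hw]
  exact hg ⟨w, hw⟩

theorem ζ_mem_unitRej (i : Fin I) : D.ζ i ∈ D.unitRej := by
  refine ⟨Pi.single_nonneg.2 (D.μ_pos i).le, ?_⟩
  simp [ζ, θ_mul_μ]

theorem rBar_nonneg : 0 ≤ D.rBar := by
  refine Real.sInf_nonneg ?_
  rintro _ ⟨z, hz, rfl⟩
  exact dotProduct_nonneg_of_nonneg (fun i => (D.r_pos i).le) hz.1

theorem rBar_le {z : Fin I → ℝ} (hz : z ∈ D.unitRej) : D.rBar ≤ D.r ⬝ᵥ z := by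
  refine csInf_le ⟨0, ?_⟩ (mem_image_of_mem _ hz)
  rintro _ ⟨z, hz, rfl⟩
  exact dotProduct_nonneg_of_nonneg (fun i => (D.r_pos i).le) hz.1

/-- This is the price comparison behind projection: rejecting one unit of class `i` costs at least
`r̄` times the workload it removes. -/
theorem rBar_mul_θ_le (i : Fin I) : D.rBar * D.θ i ≤ D.r i := by
  have h := D.rBar_le (D.ζ_mem_unitRej i)
  simp only [ζ, dotProduct_single] at h
  calc D.rBar * D.θ i ≤ D.r i * D.μ i * D.θ i := mul_le_mul_of_nonneg_right h (D.θ_pos i).le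
    _ = D.r i * (D.θ i * D.μ i) := by ring
    _ = D.r i := by rw [θ_mul_μ, mul_one]

variable {D} in
theorem IsCheapestClass.rBar_eq {i : Fin I} (hi : D.IsCheapestClass i) :
    D.rBar = D.r i * D.μ i := by
  have h : D.r ⬝ᵥ D.ζ i = D.r i * D.μ i := by simp [ζ]
  rw [← h]
  refine le_antisymm (D.rBar_le hi.1) (le_csInf ⟨_, mem_image_of_mem _ hi.1⟩ ?_)
  rintro _ ⟨z, hz, rfl⟩
  exact hi.2 hz

/-- On `unitRej`, `r · z` is an average of the numbers `r_j μ_j` with weights `θ_j z_j`, so it is at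
least the smallest of them. -/
theorem exists_isCheapestClass : ∃ i, D.IsCheapestClass i := by
  have : Nonempty (Fin I) := ⟨⟨0, D.one_le⟩⟩
  obtain ⟨i, hi⟩ := Finite.exists_min fun i => D.r i * D.μ i
  refine ⟨i, D.ζ_mem_unitRej i, fun z hz => ?_⟩
  have h : D.r ⬝ᵥ D.ζ i = D.r i * D.μ i := by simp [ζ]
  simp only [mem_ofPred_eq, h]
  calc D.r i * D.μ i = ∑ j, (D.r i * D.μ i) * (D.θ j * z j) := by
        rw [← Finset.mul_sum]
        exact (mul_one _).symm.trans (congrArg _ hz.2.symm)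
    _ ≤ ∑ j, (D.r j * D.μ j) * (D.θ j * z j) :=
        Finset.sum_le_sum fun j _ => mul_le_mul_of_nonneg_right (hi j)
          (mul_nonneg (D.θ_pos j).le (hz.1 j))
    _ = D.r ⬝ᵥ z := Finset.sum_congr rfl fun j _ => by linear_combination D.r j * z j * D.θ_mul_μ j

end BCPData

/-! ### Stieltjes measures of paths and discounted costs. -/

theorem monotone_extPath {z : ℝ≥0 → ℝ} (h0 : ∀ t, 0 ≤ z t) (hm : Monotone z) :
    Monotone (extPath z) := by
  intro s t hst
  unfold extPath
  split_ifs with hs ht ht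
  · exact le_rfl
  · exact h0 _
  · linarith
  · exact hm (Real.toNNReal_le_toNNReal hst)

theorem pathMeasure_of_monotone {z : ℝ≥0 → ℝ} (hz : Monotone (extPath z)) :
    pathMeasure z = hz.stieltjesFunction.measure := dif_pos hz

theorem extPath_zero : extPath (fun _ => 0) = fun _ => 0 := by
  funext t
  simp [extPath]

theorem extPath_add (y z : ℝ≥0 → ℝ) :
    extPath (fun t => y t + z t) = fun t => extPath y t + extPath z t := by
  funext t
  unfold extPath
  split_ifs <;> simp

theorem extPath_const_mul (c : ℝ) (z : ℝ≥0 → ℝ) :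
    extPath (fun t => c * z t) = fun t => c * extPath z t := by
  funext t
  unfold extPath
  split_ifs <;> simp

theorem pathMeasure_zero : pathMeasure (fun _ => 0) = 0 := by
  have hm : Monotone (extPath fun _ => 0) := by
    rw [extPath_zero]
    exact monotone_const
  rw [pathMeasure_of_monotone hm, ← StieltjesFunction.measure_zero]
  congr 1
  ext x
  rw [Monotone.stieltjesFunction_eq]
  refine tendsto_nhds_unique (hm.tendsto_rightLim x) ?_
  rw [extPath_zero]
  exact tendsto_const_nhds

/-- The Stieltjes function is made of right limits, and these are additive; monotonicity suffices,
without right-continuity. -/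
theorem pathMeasure_add {y z : ℝ≥0 → ℝ} (hy : Monotone (extPath y)) (hz : Monotone (extPath z)) :
    pathMeasure (fun t => y t + z t) = pathMeasure y + pathMeasure z := by
  have hm : Monotone (extPath fun t => y t + z t) := by
    rw [extPath_add]
    exact hy.add hz
  rw [pathMeasure_of_monotone hm, pathMeasure_of_monotone hy, pathMeasure_of_monotone hz,
    ← StieltjesFunction.measure_add]
  congr 1
  ext x
  rw [StieltjesFunction.add_apply]
  simp only [Monotone.stieltjesFunction_eq]
  refine tendsto_nhds_unique (hm.tendsto_rightLim x) ?_
  rw [extPath_add]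
  exact (hy.tendsto_rightLim x).add (hz.tendsto_rightLim x)

theorem pathMeasure_const_mul (c : ℝ≥0) {z : ℝ≥0 → ℝ} (hz : Monotone (extPath z)) :
    pathMeasure (fun t => c * z t) = c • pathMeasure z := by
  have hm : Monotone (extPath fun t => c * z t) := by
    rw [extPath_const_mul]
    exact hz.const_mul c.2
  rw [pathMeasure_of_monotone hm, pathMeasure_of_monotone hz, ← StieltjesFunction.measure_smul]
  congr 1
  ext x
  change Function.rightLim _ x = (c : ℝ) * Function.rightLim _ x
  refine tendsto_nhds_unique (hm.tendsto_rightLim x) ?_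
  rw [extPath_const_mul]
  exact (hz.tendsto_rightLim x).const_mul _

theorem discountedVariation_zero (α : ℝ) : discountedVariation α (fun _ => 0) = 0 := by
  simp [discountedVariation, pathMeasure_zero]

theorem discountedVariation_add (α : ℝ) {y z : ℝ≥0 → ℝ} (hy : Monotone (extPath y))
    (hz : Monotone (extPath z)) :
    discountedVariation α (fun t => y t + z t)
      = discountedVariation α y + discountedVariation α z := by
  rw [discountedVariation, pathMeasure_add hy hz, Measure.restrict_add, lintegral_add_measure]
  rfl

theorem discountedVariation_const_mul (α : ℝ) {c : ℝ} (hc : 0 ≤ c) {z : ℝ≥0 → ℝ}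
    (hz : Monotone (extPath z)) :
    discountedVariation α (fun t => c * z t) = ENNReal.ofReal c * discountedVariation α z := by
  lift c to ℝ≥0 using hc
  rw [discountedVariation, pathMeasure_const_mul c hz, Measure.restrict_smul,
    lintegral_smul_measure, ENNReal.ofReal_coe_nnreal]
  rfl

theorem discountedVariation_sum (α : ℝ) {ι : Type*} (s : Finset ι) {z : ι → ℝ≥0 → ℝ}
    (h0 : ∀ i t, 0 ≤ z i t) (hm : ∀ i, Monotone (z i)) :
    discountedVariation α (fun t => ∑ i ∈ s, z i t) = ∑ i ∈ s, discountedVariation α (z i) := by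
  classical
  induction s using Finset.induction_on with
  | empty => simpa using discountedVariation_zero α
  | insert a s ha ih =>
    simp only [Finset.sum_insert ha]
    rw [discountedVariation_add α (monotone_extPath (h0 a) (hm a)), ih]
    exact monotone_extPath (fun t => Finset.sum_nonneg fun i _ => h0 i t)
      fun t t' h => Finset.sum_le_sum fun i _ => hm i h

theorem discountedIntegral_mono {α : ℝ} {f g : ℝ≥0 → ℝ} (h : ∀ t, f t ≤ g t) :
    discountedIntegral α f ≤ discountedIntegral α g :=
  lintegral_mono fun _ => ENNReal.ofReal_le_ofReal
    (mul_le_mul_of_nonneg_left (h _) (Real.exp_pos _).le)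

theorem lintegral_exp_neg_mul_Ici {α : ℝ} (hα : 0 < α) :
    ∫⁻ t in Ici (0 : ℝ), ENNReal.ofReal (Real.exp (-α * t)) = ENNReal.ofReal α⁻¹ := by
  rw [← restrict_Ioi_eq_restrict_Ici, ← ofReal_integral_eq_lintegral_ofReal
    (integrableOn_exp_mul_Ioi (neg_lt_zero.2 hα) 0) (ae_of_all _ fun _ => (Real.exp_pos _).le),
    integral_exp_mul_Ioi (neg_lt_zero.2 hα) 0]
  congr 1
  simp [neg_div_neg_eq]

theorem discountedIntegral_add_const_le {α : ℝ} (hα : 0 < α) (f : ℝ≥0 → ℝ) (ε : ℝ) :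
    discountedIntegral α (fun t => f t + ε) ≤ discountedIntegral α f + ENNReal.ofReal (ε / α) := by
  have h : ENNReal.ofReal (ε / α)
      = ∫⁻ t in Ici (0 : ℝ), ENNReal.ofReal (Real.exp (-α * t)) * ENNReal.ofReal ε := by
    rw [lintegral_mul_const _ (by fun_prop), lintegral_exp_neg_mul_Ici hα,
      ← ENNReal.ofReal_mul (by positivity), div_eq_inv_mul]
  -- Only the constant summand has to be measurable; `f` is arbitrary.
  rw [h, discountedIntegral, discountedIntegral, ← lintegral_add_right _ (by fun_prop)]
  refine lintegral_mono fun t => ?_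
  simp only [mul_add, ← ENNReal.ofReal_mul (Real.exp_pos (-α * t)).le]
  exact ENNReal.ofReal_add_le

/-! ### Gaussian laws via characteristic functions, and Brownian increments. -/

/-- The continuous linear functional `ξ ↦ u · ξ`. -/
noncomputable def dotProductCLM {n : ℕ} (u : Fin n → ℝ) : StrongDual ℝ (Fin n → ℝ) where
  toFun ξ := u ⬝ᵥ ξ
  map_add' := dotProduct_add u
  map_smul' c ξ := dotProduct_smul c u ξ
  cont := continuous_dotProduct_left u

theorem charFunDual_gaussianReal' (a : ℝ) (v : ℝ≥0) (L : StrongDual ℝ ℝ) :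
    charFunDual (gaussianReal a v) L
      = Complex.exp (((L 1 * a : ℝ) : ℂ) * Complex.I - ((L 1 ^ 2 * v : ℝ) : ℂ) / 2) := by
  have : L a = L 1 * a := by
    conv_lhs => rw [← mul_one a, ← smul_eq_mul, map_smul, smul_eq_mul, mul_comm]
  rw [charFunDual_eq_charFun_map_one, gaussianReal_map_continuousLinearMap, charFun_gaussianReal,
    this]
  simp [max_eq_left (sq_nonneg (L 1))]

theorem charFunDual_pi_gaussianReal {ι : Type*} [Fintype ι] [DecidableEq ι] (a : ι → ℝ)
    (v : ι → ℝ≥0) (L : StrongDual ℝ (ι → ℝ)) :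
    charFunDual (Measure.pi fun i => gaussianReal (a i) (v i)) L
      = Complex.exp (((∑ i, L (Pi.single i 1) * a i : ℝ) : ℂ) * Complex.I
          - ((∑ i, L (Pi.single i 1) ^ 2 * v i : ℝ) : ℂ) / 2) := by
  rw [charFunDual_pi]
  simp only [charFunDual_gaussianReal', ← Complex.exp_sum]
  congr 1
  rw [Finset.sum_sub_distrib, ← Finset.sum_mul, ← Finset.sum_div]
  simp

theorem map_dotProduct_pi_gaussianReal {n : ℕ} (u a : Fin n → ℝ) (v : Fin n → ℝ≥0) {b : ℝ}
    {w : ℝ≥0} (hb : b = ∑ i, u i * a i) (hw : (w : ℝ) = ∑ i, u i ^ 2 * v i) :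
    (Measure.pi fun i => gaussianReal (a i) (v i)).map (fun ξ => u ⬝ᵥ ξ) = gaussianReal b w := by
  have : IsProbabilityMeasure
      ((Measure.pi fun i => gaussianReal (a i) (v i)).map (dotProductCLM u)) :=
    Measure.isProbabilityMeasure_map (by fun_prop)
  change (Measure.pi fun i => gaussianReal (a i) (v i)).map (dotProductCLM u) = _
  refine Measure.ext_of_charFunDual (funext fun L => ?_)
  have hL (i : Fin n) : (L ∘SL dotProductCLM u) (Pi.single i 1) = L 1 * u i := by
    change L (u ⬝ᵥ Pi.single i 1) = _
    rw [dotProduct_single, mul_one, mul_comm, ← smul_eq_mul, ← map_smul, smul_eq_mul, mul_one]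
  rw [charFunDual_map, charFunDual_pi_gaussianReal, charFunDual_gaussianReal', hb, hw]
  simp only [hL, Finset.mul_sum, mul_pow, mul_assoc]

/-- An affine image of a centered isotropic Gaussian vector with diagonal covariance has
independent components. -/
theorem map_affine_pi_gaussianReal {ι κ : Type*} [Fintype ι] [Fintype κ] [DecidableEq ι]
    [DecidableEq κ] (A : (κ → ℝ) →L[ℝ] (ι → ℝ)) (b : ι → ℝ) (s : ι → ℝ≥0) (τ : ℝ≥0)
    (hA : ∀ L : StrongDual ℝ (ι → ℝ),
      ∑ k, L (A (Pi.single k 1)) ^ 2 = ∑ i, L (Pi.single i 1) ^ 2 * s i) :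
    (Measure.pi fun _ : κ => gaussianReal 0 τ).map (fun x => A x + b)
      = Measure.pi fun i => gaussianReal (b i) (s i * τ) := by
  have : IsProbabilityMeasure ((Measure.pi fun _ : κ => gaussianReal 0 τ).map A) :=
    Measure.isProbabilityMeasure_map (by fun_prop)
  have hmap : (Measure.pi fun _ : κ => gaussianReal 0 τ).map (fun x => A x + b)
      = ((Measure.pi fun _ : κ => gaussianReal 0 τ).map A).map (fun x => x + b) := by
    rw [Measure.map_map (by fun_prop) (by fun_prop)]
    rfl
  have : IsProbabilityMeasure
      (((Measure.pi fun _ : κ => gaussianReal 0 τ).map A).map (fun x => x + b)) :=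
    Measure.isProbabilityMeasure_map (by fun_prop)
  rw [hmap]
  refine Measure.ext_of_charFunDual (funext fun L => ?_)
  have hb : L b = ∑ i, L (Pi.single i 1) * b i := by
    conv_lhs => rw [pi_eq_sum_univ' b, map_sum]
    refine Finset.sum_congr rfl fun i _ => ?_
    rw [map_smul, smul_eq_mul, mul_comm]
  -- `hA` is the covariance identity `A Aᵀ = diag s`, tested as a quadratic form on `L`.
  have hv : ∑ k, L (A (Pi.single k 1)) ^ 2 * (τ : ℝ)
      = ∑ i, L (Pi.single i 1) ^ 2 * ((s i * τ : ℝ≥0) : ℝ) := by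
    rw [← Finset.sum_mul, hA L, Finset.sum_mul]
    exact Finset.sum_congr rfl fun i _ => by push_cast; ring
  rw [charFunDual_map_add_const, charFunDual_map, charFunDual_pi_gaussianReal,
    charFunDual_pi_gaussianReal, ← Complex.exp_add, hb, ← hv]
  congr 1
  simp
  ring

theorem IsVecBM.dotProduct {n : ℕ} {m σ : Fin n → ℝ} {Ω : Type*} [MeasurableSpace Ω]
    {P : Measure Ω} {W : ℝ≥0 → Ω → Fin n → ℝ} (hW : IsVecBM m σ P W) (u : Fin n → ℝ) {s : ℝ}
    (hs : s ^ 2 = ∑ i, u i ^ 2 * σ i ^ 2) :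
    IsRealBM (u ⬝ᵥ m) s P (fun t ω => u ⬝ᵥ W t ω) where
  zero := by
    filter_upwards [hW.zero] with ω h
    rw [h, dotProduct_zero]
  cont := by
    filter_upwards [hW.cont] with ω h
    exact (continuous_dotProduct_left u).comp h
  indep := hW.indep.map (dotProductCLM u)
  law := by
    intro a b hab
    have hlaw : HasLaw (fun ξ => u ⬝ᵥ ξ)
        (gaussianReal (u ⬝ᵥ m * ((b : ℝ) - a)) ((s ^ 2).toNNReal * (b - a)))
        (Measure.pi fun i => gaussianReal (m i * ((b : ℝ) - a)) ((σ i ^ 2).toNNReal * (b - a))) :=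
      ⟨(continuous_dotProduct_left u).aemeasurable, map_dotProduct_pi_gaussianReal _ _ _
        (by rw [_root_.dotProduct, Finset.sum_mul]; exact Finset.sum_congr rfl fun i _ => by ring)
        (by
          push_cast
          rw [Real.coe_toNNReal _ (sq_nonneg s), hs, Finset.sum_mul]
          refine Finset.sum_congr rfl fun i _ => ?_
          rw [Real.coe_toNNReal _ (sq_nonneg _)]
          ring)⟩
    have := hlaw.comp (hW.law a b hab)
    simpa only [Function.comp_def, dotProduct_sub] using this

/-- A process adapted to a filtration whose increments are independent of the past has independent
increments. -/
theorem hasIndepIncrements_of_adapted {E : Type*} [AddGroup E] [MeasurableSpace E]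
    [MeasurableSub₂ E] {Ω : Type*} {mΩ : MeasurableSpace Ω} {P : Measure Ω}
    [IsProbabilityMeasure P] {𝓕 : Filtration ℝ≥0 mΩ} {W : ℝ≥0 → Ω → E} (hW : Adapted 𝓕 W)
    (hind : ∀ s t : ℝ≥0, s < t →
      Indep (MeasurableSpace.comap (fun ω => W t ω - W s ω) inferInstance) (𝓕 s) P) :
    HasIndepIncrements W P := by
  rw [hasIndepIncrements_iff_nat]
  intro t ht
  rw [iIndepFun_iff_measure_inter_preimage_eq_mul]
  intro S A hA
  induction S using Finset.induction_on_max with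
  | empty => simp
  | insert a S ha ih =>
    have hmem : a ∉ S := fun h => (ha a h).false
    rw [Finset.set_biInter_insert, Finset.prod_insert hmem,
      ← ih fun i hi => hA i (Finset.mem_insert_of_mem hi)]
    have hI : Indep (MeasurableSpace.comap (fun ω => W (t (a + 1)) ω - W (t a) ω) inferInstance)
        (𝓕 (t a)) P := by
      -- The times are only weakly increasing, whereas `hind` needs `s < t`; a repeated time gives a
      -- zero increment.
      rcases (ht a.le_succ).eq_or_lt with h | h
      · have : (fun ω => W (t (a + 1)) ω - W (t a) ω) = fun _ => 0 := by
          funext ω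
          rw [show t (a + 1) = t a from h.symm, sub_self]
        rw [this, MeasurableSpace.comap_const]
        exact indep_bot_left _
      · exact hind _ _ h
    refine (Indep_iff _ _ _).1 hI _ _ ⟨A a, hA a (Finset.mem_insert_self _ _), rfl⟩ ?_
    refine Finset.measurableSet_biInter S fun i hi => ?_
    -- Here `i < a` is used as `i + 1 ≤ a`: every earlier increment is known at time `t a`.
    have h1 : Measurable[𝓕 (t a)] (W (t (i + 1))) :=
      (hW _).mono (𝓕.mono (ht (ha i hi))) le_rfl
    have h2 : Measurable[𝓕 (t a)] (W (t i)) :=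
      (hW _).mono (𝓕.mono (ht (ha i hi).le)) le_rfl
    exact (h1.sub h2) (hA i (Finset.mem_insert_of_mem hi))

/-! ### Stability of RCLL paths. -/

theorem Continuous.isRCLL {E : Type*} [TopologicalSpace E] {f : ℝ≥0 → E} (hf : Continuous f) :
    IsRCLL f :=
  fun t => ⟨hf.continuousWithinAt, f t, hf.continuousAt.tendsto.mono_left nhdsWithin_le_nhds⟩

theorem IsRCLL.continuousOn_comp {E F : Type*} [TopologicalSpace E] [TopologicalSpace F]
    {f : ℝ≥0 → E} (hf : IsRCLL f) {s : Set E} (hs : IsClosed s) (hfs : ∀ t, f t ∈ s) {g : E → F}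
    (hg : ContinuousOn g s) : IsRCLL fun t => g (f t) := by
  intro t
  refine ⟨(hg (f t) (hfs t)).comp (hf t).1 fun x _ => hfs x, ?_⟩
  -- When the left filter is trivial (`t = 0`), a limit `l` need not lie in `s`; otherwise
  -- closedness of `s` puts it there.
  rcases eq_or_neBot (𝓝[<] t) with h | h
  · exact ⟨g (f t), by rw [h]; exact tendsto_bot⟩
  · obtain ⟨l, hl⟩ := (hf t).2
    exact ⟨g l, ((hg l (hs.mem_of_tendsto hl (.of_forall hfs))).tendsto).comp
      (tendsto_nhdsWithin_iff.2 ⟨hl, .of_forall hfs⟩)⟩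

theorem IsRCLL.continuous_comp {E F : Type*} [TopologicalSpace E] [TopologicalSpace F]
    {f : ℝ≥0 → E} (hf : IsRCLL f) {g : E → F} (hg : Continuous g) : IsRCLL fun t => g (f t) :=
  hf.continuousOn_comp isClosed_univ (fun _ => mem_univ _) hg.continuousOn

theorem IsRCLL.add {E : Type*} [TopologicalSpace E] [AddGroup E] [IsTopologicalAddGroup E]
    {f g : ℝ≥0 → E} (hf : IsRCLL f) (hg : IsRCLL g) : IsRCLL fun t => f t + g t := by
  intro t
  obtain ⟨l, hl⟩ := (hf t).2
  obtain ⟨k, hk⟩ := (hg t).2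
  exact ⟨(hf t).1.add (hg t).1, l + k, hl.add hk⟩

theorem IsRCLL.sub {E : Type*} [TopologicalSpace E] [AddGroup E] [IsTopologicalAddGroup E]
    {f g : ℝ≥0 → E} (hf : IsRCLL f) (hg : IsRCLL g) : IsRCLL fun t => f t - g t := by
  intro t
  obtain ⟨l, hl⟩ := (hf t).2
  obtain ⟨k, hk⟩ := (hg t).2
  exact ⟨(hf t).1.sub (hg t).1, l - k, hl.sub hk⟩

/-! ### Projection to the reduced problem and lifting back. -/

namespace BCPData

variable {I : ℕ} (D : BCPData I)

section Projection

theorem redState_proj (x₀ : Fin I → ℝ) {Ω : Type*} (W Y Z : ℝ≥0 → Ω → Fin I → ℝ) :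
    redState (D.θ ⬝ᵥ x₀) (D.proj W) (D.proj Y) (D.proj Z) = D.proj (state x₀ W Y Z) := by
  funext t ω
  simp only [redState, proj, state, dotProduct_sub, dotProduct_add]

variable {D} {x₀ : Fin I → ℝ} {Ω : Type*} {mΩ : MeasurableSpace Ω} {P : Measure Ω}
  {𝓕 : Filtration ℝ≥0 mΩ} {W Y Z : ℝ≥0 → Ω → Fin I → ℝ}

/-- Relaxed controls suffice, since the reduced problem sees `Y` only through `θ · Y`. -/
theorem IsRelaxedControl.isRedAdmissible_proj (h : D.IsRelaxedControl x₀ P 𝓕 W Y Z) :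
    D.IsRedAdmissible (D.θ ⬝ᵥ x₀) P 𝓕 (D.proj W) (D.proj Y) (D.proj Z) where
  bm := h.bm.dotProduct D.θ D.σBar_sq
  adapted_W t := (continuous_dotProduct_left D.θ).measurable.comp (h.adapted_W t)
  adapted_Y t := (continuous_dotProduct_left D.θ).measurable.comp (h.adapted_Y t)
  adapted_Z t := (continuous_dotProduct_left D.θ).measurable.comp (h.adapted_Z t)
  indep s t hst := by
    refine indep_of_indep_of_le_left (h.indep s t hst) ?_
    rintro _ ⟨A, hA, rfl⟩
    refine ⟨(fun ξ => D.θ ⬝ᵥ ξ) ⁻¹' A, (continuous_dotProduct_left D.θ).measurable hA, ?_⟩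
    ext ω
    simp only [mem_preimage, proj, dotProduct_sub]
  rcll_Y := h.rcll_θY
  rcll_Z := by
    filter_upwards [h.rcll_Z] with ω hω
    exact hω.continuous_comp (continuous_dotProduct_left D.θ)
  nonneg_Y := h.nonneg_θY
  nonneg_Z := by
    filter_upwards [h.nonneg_Z] with ω hω t
    exact dotProduct_nonneg_of_nonneg (fun i => (D.θ_pos i).le) (hω t)
  mono_Y := h.mono_θY
  mono_Z := by
    filter_upwards [h.mono_Z] with ω hω s t hst
    simp only [proj, dotProduct]
    gcongr with i
    · exact (D.θ_pos i).le
    · exact hω i hst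
  state_mem := by
    filter_upwards [h.state_mem] with ω hω t
    rw [redState_proj]
    exact D.θ_dotProduct_mem_Icc (hω t)

theorem IsRelaxedControl.redCost_proj_le (h : D.IsRelaxedControl x₀ P 𝓕 W Y Z) :
    D.redCost (D.θ ⬝ᵥ x₀) P (D.proj W) (D.proj Y) (D.proj Z) ≤ D.cost x₀ P W Y Z := by
  refine lintegral_mono_ae ?_
  filter_upwards [h.nonneg_Z, h.mono_Z, h.state_mem] with ω h0 hm hs
  refine add_le_add ?_ ?_
  · rw [redState_proj]
    exact discountedIntegral_mono fun t => D.hBar_le ⟨hs t, rfl⟩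
  · have hθ (i : Fin I) : 0 ≤ D.θ i := (D.θ_pos i).le
    have hsum : discountedVariation D.α (fun t => D.proj Z t ω)
        = ∑ i, ENNReal.ofReal (D.θ i) * discountedVariation D.α (fun t => Z t ω i) := by
      refine (discountedVariation_sum D.α Finset.univ (z := fun i t => D.θ i * Z t ω i)
        (fun i t => mul_nonneg (hθ i) (h0 t i)) (fun i => (hm i).const_mul (hθ i))).trans ?_
      exact Finset.sum_congr rfl fun i _ => discountedVariation_const_mul D.α (hθ i)
        (monotone_extPath (fun t => h0 t i) (hm i))
    rw [hsum, Finset.mul_sum]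
    refine Finset.sum_le_sum fun i _ => ?_
    rw [← mul_assoc, ← ENNReal.ofReal_mul D.rBar_nonneg]
    gcongr
    exact D.rBar_mul_θ_le i

end Projection

section Lifting

theorem state_lift (γ : ℝ → Fin I → ℝ) (i : Fin I) (x₀ : Fin I → ℝ) {Ω : Type*}
    (W : ℝ≥0 → Ω → Fin I → ℝ) (Xb Zb : ℝ≥0 → Ω → ℝ) :
    state x₀ W (D.liftY γ i x₀ W Xb Zb) (D.liftZ i Zb) = fun t ω => γ (Xb t ω) := by
  funext t ω
  simp only [state, liftY]
  abel

variable {D} {x₀ : Fin I → ℝ} {γ : ℝ → Fin I → ℝ} {i : Fin I} {Ω : Type*} {mΩ : MeasurableSpace Ω}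
  {P : Measure Ω} {𝓕 : Filtration ℝ≥0 mΩ} {Wb Yb Zb : ℝ≥0 → Ω → ℝ}
  {W : ℝ≥0 → Ω → Fin I → ℝ}

/-- Since `θ · γ(w) = w` and `θ · ζ = 1`, the workload of `Y` is `X̄ - x̄₀ - W̄ + Z̄ = Ȳ`. Hence `θ
· Y` keeps its regularity even where `γ` jumps. -/
theorem proj_liftY_ae (h : D.IsRedAdmissible (D.θ ⬝ᵥ x₀) P 𝓕 Wb Yb Zb)
    (hγ : ∀ w ∈ Icc 0 D.xMax, γ w ∈ D.fiber w) (hWb : ∀ᵐ ω ∂P, ∀ t, D.proj W t ω = Wb t ω) :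
    ∀ᵐ ω ∂P, ∀ t, D.proj (D.liftY γ i x₀ W (redState (D.θ ⬝ᵥ x₀) Wb Yb Zb) Zb) t ω = Yb t ω := by
  filter_upwards [h.state_mem, hWb] with ω hs hW t
  have h1 := (hγ _ (hs t)).2
  have h2 := hW t
  simp only [proj] at h2
  simp only [proj, liftY, liftZ, dotProduct_add, dotProduct_sub, dotProduct_smul, h1, h2,
    (D.ζ_mem_unitRej i).2, smul_eq_mul, mul_one]
  simp only [redState]
  ring

/-- Optimality of `γ` and of class `i` matters only for the cost. Any Borel selection of the fibers
is allowed here, so that the lemma serves both the exact curve and the `ε`-optimal one. -/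
theorem IsRedAdmissible.isRelaxedControl_lift (h : D.IsRedAdmissible (D.θ ⬝ᵥ x₀) P 𝓕 Wb Yb Zb)
    (hγm : Measurable γ) (hγ : ∀ w ∈ Icc 0 D.xMax, γ w ∈ D.fiber w) (hbm : IsVecBM D.m D.σ P W)
    (hW : Adapted 𝓕 W) (hWb : ∀ᵐ ω ∂P, ∀ t, D.proj W t ω = Wb t ω)
    (hind : ∀ s t : ℝ≥0, s < t →
      Indep (MeasurableSpace.comap (fun ω => W t ω - W s ω) inferInstance) (𝓕 s) P) :
    D.IsRelaxedControl x₀ P 𝓕 W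
      (D.liftY γ i x₀ W (redState (D.θ ⬝ᵥ x₀) Wb Yb Zb) Zb) (D.liftZ i Zb) where
  bm := hbm
  adapted_W := hW
  adapted_Y t := by
    have hX : Measurable[𝓕 t] (redState (D.θ ⬝ᵥ x₀) Wb Yb Zb t) :=
      (((h.adapted_W t).const_add _).add (h.adapted_Y t)).sub (h.adapted_Z t)
    exact (((hγm.comp hX).sub_const _).sub (hW t)).add ((h.adapted_Z t).smul_const _)
  adapted_Z t := (h.adapted_Z t).smul_const _
  indep := hind
  rcll_Z := by
    filter_upwards [h.rcll_Z] with ω hω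
    exact hω.continuous_comp (g := fun z : ℝ => z • D.ζ i) (by fun_prop)
  rcll_θY := by
    filter_upwards [h.rcll_Y, proj_liftY_ae (i := i) h hγ hWb] with ω hω e
    simpa only [e] using hω
  nonneg_θY := by
    filter_upwards [h.nonneg_Y, proj_liftY_ae (i := i) h hγ hWb] with ω hω e
    simpa only [e] using hω
  mono_θY := by
    filter_upwards [h.mono_Y, proj_liftY_ae (i := i) h hγ hWb] with ω hω e
    simpa only [e] using hω
  nonneg_Z := by
    filter_upwards [h.nonneg_Z] with ω hω t
    exact smul_nonneg (hω t) (D.ζ_mem_unitRej i).1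
  mono_Z := by
    filter_upwards [h.mono_Z] with ω hω j s t hst
    exact mul_le_mul_of_nonneg_right (hω hst) ((D.ζ_mem_unitRej i).1 j)
  state_mem := by
    filter_upwards [h.state_mem] with ω hω t
    rw [state_lift]
    exact (hγ _ (hω t)).1

/-- `Y` and `γ(X̄)` differ by `Z - x₀ - W`, which is RCLL almost surely. -/
theorem rcll_liftY_iff (hZ : ∀ᵐ ω ∂P, IsRCLL fun t => Zb t ω)
    (hW : ∀ᵐ ω ∂P, Continuous fun t => W t ω) {Xb : ℝ≥0 → Ω → ℝ} :
    (∀ᵐ ω ∂P, IsRCLL fun t => D.liftY γ i x₀ W Xb Zb t ω) ↔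
      ∀ᵐ ω ∂P, IsRCLL fun t => γ (Xb t ω) := by
  have hZ' : ∀ᵐ ω ∂P, IsRCLL fun t => D.liftZ i Zb t ω := by
    filter_upwards [hZ] with ω hω
    exact hω.continuous_comp (g := fun z : ℝ => z • D.ζ i) (by fun_prop)
  refine eventually_congr ?_
  filter_upwards [hZ', hW] with ω hz hw
  have hw' : IsRCLL fun t => x₀ + W t ω := (continuous_const.add hw).isRCLL
  constructor
  · intro h
    have := (hw'.add h).sub hz
    convert! this using 2 with t
    simp only [liftY]
    abel
  · intro h
    have := (h.sub hw').add hz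
    convert! this using 2 with t
    simp only [liftY]
    abel

theorem IsRedAdmissible.rcll_comp_redState {w₀ : ℝ} (h : D.IsRedAdmissible w₀ P 𝓕 Wb Yb Zb)
    (hγ : ContinuousOn γ (Icc 0 D.xMax)) :
    ∀ᵐ ω ∂P, IsRCLL fun t => γ (redState w₀ Wb Yb Zb t ω) := by
  filter_upwards [h.rcll_Y, h.rcll_Z, h.bm.cont, h.state_mem] with ω hY hZ hW hs
  have hX : IsRCLL fun t => redState w₀ Wb Yb Zb t ω :=
    ((continuous_const.add hW).isRCLL.add hY).sub hZ
  exact hX.continuousOn_comp isClosed_Icc hs hγ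

theorem sum_discountedVariation_liftZ (hi : D.IsCheapestClass i) {ω : Ω}
    (h0 : ∀ t, 0 ≤ Zb t ω) (hm : Monotone fun t => Zb t ω) :
    ∑ j, ENNReal.ofReal (D.r j) * discountedVariation D.α (fun t => D.liftZ i Zb t ω j)
      = ENNReal.ofReal D.rBar * discountedVariation D.α (fun t => Zb t ω) := by
  have hv (j : Fin I) : discountedVariation D.α (fun t => D.liftZ i Zb t ω j)
      = ENNReal.ofReal (D.ζ i j) * discountedVariation D.α (fun t => Zb t ω) := by
    rw [← discountedVariation_const_mul D.α ((D.ζ_mem_unitRej i).1 j) (monotone_extPath h0 hm)]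
    simp only [liftZ, Pi.smul_apply, smul_eq_mul, mul_comm]
  simp only [hv]
  rw [Finset.sum_eq_single i]
  · rw [← mul_assoc, ← ENNReal.ofReal_mul (D.r_pos i).le, hi.rBar_eq]
    simp [ζ]
  · intro j _ hj
    simp [ζ, hj]
  · simp

theorem IsRedAdmissible.cost_lift_eq {w₀ : ℝ} (h : D.IsRedAdmissible w₀ P 𝓕 Wb Yb Zb)
    (hγ : D.IsMinimizingCurve γ) (hi : D.IsCheapestClass i) :
    D.cost x₀ P W (D.liftY γ i x₀ W (redState w₀ Wb Yb Zb) Zb) (D.liftZ i Zb)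
      = D.redCost w₀ P Wb Yb Zb := by
  refine lintegral_congr_ae ?_
  filter_upwards [h.nonneg_Z, h.mono_Z, h.state_mem] with ω h0 hm hs
  rw [state_lift, sum_discountedVariation_liftZ hi h0 hm]
  congr 2
  funext t
  exact (D.hBar_eq_of_isMinOn (hγ.mem _ (hs t)) (hγ.isMin _ (hs t))).symm

theorem IsRedAdmissible.cost_lift_le [IsProbabilityMeasure P] {w₀ : ℝ}
    (h : D.IsRedAdmissible w₀ P 𝓕 Wb Yb Zb) {ε : ℝ}
    (hγ : ∀ w ∈ Icc 0 D.xMax, D.h ⬝ᵥ γ w ≤ D.hBar w + ε) (hi : D.IsCheapestClass i) :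
    D.cost x₀ P W (D.liftY γ i x₀ W (redState w₀ Wb Yb Zb) Zb) (D.liftZ i Zb)
      ≤ D.redCost w₀ P Wb Yb Zb + ENNReal.ofReal (ε / D.α) := by
  have hc : ENNReal.ofReal (ε / D.α) = ∫⁻ _, ENNReal.ofReal (ε / D.α) ∂P := by simp
  -- Measurability of the constant is enough, so none is needed for the pathwise cost.
  rw [hc, redCost, ← lintegral_add_right _ measurable_const]
  refine lintegral_mono_ae ?_
  filter_upwards [h.nonneg_Z, h.mono_Z, h.state_mem] with ω h0 hm hs
  rw [state_lift, sum_discountedVariation_liftZ hi h0 hm, add_right_comm]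
  gcongr
  exact (discountedIntegral_mono fun t => hγ _ (hs t)).trans
    (discountedIntegral_add_const_le D.α_pos _ ε)

end Lifting

end BCPData

/-! ### Powers of a filtered probability space. -/

/-- Powers of independent σ-algebras are independent under the power measure. -/
theorem ProbabilityTheory.Indep.pi {κ Ω : Type*} [Fintype κ] {m₁ m₂ mΩ : MeasurableSpace Ω}
    {P : Measure Ω} [IsProbabilityMeasure P] (h₁ : m₁ ≤ mΩ) (h₂ : m₂ ≤ mΩ)
    (h : Indep m₁ m₂ P) :
    Indep (@MeasurableSpace.pi κ (fun _ => Ω) (fun _ => m₁))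
      (@MeasurableSpace.pi κ (fun _ => Ω) (fun _ => m₂)) (Measure.pi fun _ : κ => P) := by
  -- Measurable boxes form generating π-systems, and on boxes independence factors over the
  -- coordinates.
  refine IndepSets.indep (iSup_mono fun _ => MeasurableSpace.comap_mono h₁)
    (iSup_mono fun _ => MeasurableSpace.comap_mono h₂)
    (@isPiSystem_pi κ (fun _ => Ω) (fun _ => m₁)) (@isPiSystem_pi κ (fun _ => Ω) (fun _ => m₂))
    (@generateFrom_pi κ (fun _ => Ω) _ (fun _ => m₁)).symm
    (@generateFrom_pi κ (fun _ => Ω) _ (fun _ => m₂)).symm ?_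
  rw [IndepSets_iff]
  rintro _ _ ⟨A, hA, rfl⟩ ⟨C, hC, rfl⟩
  rw [← pi_inter_distrib, Measure.pi_pi, Measure.pi_pi, Measure.pi_pi, ← Finset.prod_mul_distrib]
  exact Finset.prod_congr rfl fun k _ =>
    (Indep_iff _ _ _).1 h _ _ (hA k (mem_univ k)) (hC k (mem_univ k))

section ProductSpace

variable {Ω : Type*} {mΩ : MeasurableSpace Ω}

/-- The product filtration on `κ → Ω`. -/
def piFiltration (κ : Type*) (𝓕 : Filtration ℝ≥0 mΩ) :
    Filtration ℝ≥0 (MeasurableSpace.pi : MeasurableSpace (κ → Ω)) where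
  seq t := @MeasurableSpace.pi κ (fun _ => Ω) (fun _ => 𝓕 t)
  mono' _ _ hst := iSup_mono fun _ => MeasurableSpace.comap_mono (𝓕.mono hst)
  le' t := iSup_mono fun _ => MeasurableSpace.comap_mono (𝓕.le t)

theorem Measurable.comp_eval_piFiltration {κ E : Type*} [MeasurableSpace E]
    {𝓕 : Filtration ℝ≥0 mΩ} {t : ℝ≥0} {f : Ω → E} (hf : Measurable[𝓕 t] f) (k : κ) :
    Measurable[piFiltration κ 𝓕 t] fun ω : κ → Ω => f (ω k) :=
  @Measurable.comp _ _ _ (piFiltration κ 𝓕 t) (𝓕 t) _ _ _ hf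
    (@measurable_pi_apply κ (fun _ => Ω) (fun _ => 𝓕 t) k)

/-- The vector of copies of `f` is measurable for the power of the σ-algebra of `f`, which
`Indep.pi` makes independent of the product filtration; applying `g` only shrinks the σ-algebra. -/
theorem indep_comap_pi_piFiltration {κ : Type*} [Fintype κ] {P : Measure Ω}
    [IsProbabilityMeasure P] {𝓕 : Filtration ℝ≥0 mΩ} {s : ℝ≥0} {f : Ω → ℝ} (hf : Measurable f)
    (h : Indep (MeasurableSpace.comap f inferInstance) (𝓕 s) P)
    {E : Type*} [MeasurableSpace E] {g : (κ → ℝ) → E} (hg : Measurable g) :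
    Indep (MeasurableSpace.comap (fun ω : κ → Ω => g fun k => f (ω k)) inferInstance)
      (piFiltration κ 𝓕 s) (Measure.pi fun _ : κ => P) := by
  refine indep_of_indep_of_le_left (Indep.pi hf.comap_le (𝓕.le s) h) ?_
  have hm : @Measurable (κ → Ω) (κ → ℝ)
      (@MeasurableSpace.pi κ (fun _ => Ω) (fun _ => MeasurableSpace.comap f inferInstance))
      MeasurableSpace.pi (fun ω k => f (ω k)) := by
    refine @measurable_pi_lambda _ _ _ (_) _ _ fun k => ?_
    exact @Measurable.comp _ _ _ (_) (MeasurableSpace.comap f inferInstance) _ _ _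
      (comap_measurable f)
      (@measurable_pi_apply κ (fun _ => Ω) (fun _ => MeasurableSpace.comap f inferInstance) k)
  exact (@Measurable.comp _ _ _ (_) _ _ _ _ hg hm).comap_le

theorem ae_eval_of_ae {κ : Type*} [Fintype κ] {P : Measure Ω} [IsProbabilityMeasure P]
    {p : Ω → Prop} (h : ∀ᵐ ω ∂P, p ω) (k : κ) : ∀ᵐ ω ∂Measure.pi fun _ : κ => P, p (ω k) :=
  (measurePreserving_eval (fun _ : κ => P) k).quasiMeasurePreserving.ae h

/-- Pulling a (not necessarily measurable) function back to a power of the space does not increase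
its lower integral. -/
theorem lintegral_pi_eval_zero_le {n : ℕ} {P : Measure Ω} [IsProbabilityMeasure P]
    (F : Ω → ℝ≥0∞) :
    ∫⁻ ω, F (ω 0) ∂(Measure.pi fun _ : Fin (n + 1) => P) ≤ ∫⁻ ω, F ω ∂P := by
  have hmp := measurePreserving_piFinSuccAbove (fun _ : Fin (n + 1) => P) 0
  have e : ∫⁻ ω, F (ω 0) ∂(Measure.pi fun _ : Fin (n + 1) => P)
      = ∫⁻ x : Ω × (Fin n → Ω), F x.1 ∂(P.prod (Measure.pi fun _ : Fin n => P)) :=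
    hmp.lintegral_comp_emb (MeasurableEquiv.measurableEmbedding _) fun x => F x.1
  rw [e]
  -- A measurable minorant `g` with the same integral makes Tonelli available; its average over the
  -- extra coordinates stays below `F`.
  obtain ⟨g, hgm, hgF, hg⟩ := exists_measurable_le_lintegral_eq
    (P.prod (Measure.pi fun _ : Fin n => P)) fun x => F x.1
  rw [hg, lintegral_prod _ hgm.aemeasurable]
  refine lintegral_mono fun ω => ?_
  calc ∫⁻ y, g (ω, y) ∂(Measure.pi fun _ : Fin n => P)
      ≤ ∫⁻ _, F ω ∂(Measure.pi fun _ : Fin n => P) := lintegral_mono fun y => hgF (ω, y)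
    _ = F ω := by simp

end ProductSpace

/-! ### Brownian motion in `ℝ^I` with a prescribed workload. -/

/-- Given a unit vector `u`, this maps a standard Gaussian vector `(x₀, x)` of dimension `n + 1` to
`diag σ (x - (u · x) u + x₀ u)`, a Gaussian vector with covariance `diag σ²`. -/
noncomputable def gaussianSwap {n : ℕ} (σ u : Fin n → ℝ) :
    (Fin (n + 1) → ℝ) →L[ℝ] (Fin n → ℝ) :=
  ContinuousLinearMap.pi fun i => σ i • (ContinuousLinearMap.proj i.succ
    - u i • ∑ j : Fin n, u j • ContinuousLinearMap.proj (R := ℝ) (φ := fun _ => ℝ) j.succ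
    + u i • ContinuousLinearMap.proj 0)

theorem gaussianSwap_apply {n : ℕ} (σ u : Fin n → ℝ) (x : Fin (n + 1) → ℝ) (i : Fin n) :
    gaussianSwap σ u x i = σ i * (x i.succ - u i * ∑ j, u j * x j.succ + u i * x 0) := by
  simp [gaussianSwap]
  ring

/-- With `d_i = L(e_i) σ_i` and `q = d · u`, the columns contribute `q` and `d_j - q u_j`. The claim
is Pythagoras: `|d|² = q² + |d - q u|²`. -/
theorem sum_sq_gaussianSwap {n : ℕ} (σ u : Fin n → ℝ) (hu : ∑ i, u i ^ 2 = 1)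
    (L : StrongDual ℝ (Fin n → ℝ)) :
    ∑ k, L (gaussianSwap σ u (Pi.single k 1)) ^ 2
      = ∑ i, L (Pi.single i 1) ^ 2 * ((σ i ^ 2).toNNReal : ℝ) := by
  have hL (v : Fin n → ℝ) : L v = ∑ i, L (Pi.single i 1) * v i := by
    conv_lhs => rw [pi_eq_sum_univ' v, map_sum]
    refine Finset.sum_congr rfl fun i _ => ?_
    rw [map_smul, smul_eq_mul, mul_comm]
  set d : Fin n → ℝ := fun i => L (Pi.single i 1) * σ i with hd
  set q : ℝ := ∑ i, d i * u i with hq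
  have h0 : L (gaussianSwap σ u (Pi.single 0 1)) = q := by
    rw [hL]
    refine Finset.sum_congr rfl fun i _ => ?_
    simp [gaussianSwap_apply, hd, mul_assoc]
  have hs (j : Fin n) : L (gaussianSwap σ u (Pi.single j.succ 1)) = d j - q * u j := by
    have h1 (i : Fin n) : gaussianSwap σ u (Pi.single j.succ 1) i
        = σ i * (Pi.single (M := fun _ => ℝ) j 1 i - u i * u j) := by
      simp [gaussianSwap_apply, Pi.single_apply]
    rw [hL]
    simp only [h1]
    calc ∑ i, L (Pi.single i 1) * (σ i * (Pi.single (M := fun _ => ℝ) j 1 i - u i * u j))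
        = ∑ i, (d i * Pi.single (M := fun _ => ℝ) j 1 i - d i * u i * u j) :=
          Finset.sum_congr rfl fun i _ => by simp only [hd]; ring
      _ = d j - q * u j := by
          rw [Finset.sum_sub_distrib, ← Finset.sum_mul]
          simp [Pi.single_apply, ← hq]
  rw [Fin.sum_univ_succ, h0]
  simp only [hs]
  calc q ^ 2 + ∑ j, (d j - q * u j) ^ 2
      = q ^ 2 + (∑ j, d j ^ 2 - 2 * q * ∑ j, d j * u j + q ^ 2 * ∑ j, u j ^ 2) := by
        have h2 : ∀ c : ℝ, ∑ j, (d j - c * u j) ^ 2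
            = ∑ j, d j ^ 2 - 2 * c * ∑ j, d j * u j + c ^ 2 * ∑ j, u j ^ 2 := fun c => by
          rw [Finset.mul_sum, Finset.mul_sum, ← Finset.sum_sub_distrib, ← Finset.sum_add_distrib]
          exact Finset.sum_congr rfl fun j _ => by ring
        rw [h2]
    _ = ∑ j, d j ^ 2 := by
        rw [hu, ← hq]
        ring
    _ = _ := Finset.sum_congr rfl fun i _ => by
        rw [Real.coe_toNNReal _ (sq_nonneg _), hd, mul_pow]

namespace BCPData

variable {I : ℕ} (D : BCPData I)

/-- The direction `θ_i σ_i / σ̄` in which the workload diffuses. -/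
noncomputable def workloadDir : Fin I → ℝ := fun i => D.θ i * D.σ i / D.σBar

theorem sum_workloadDir_sq : ∑ i, D.workloadDir i ^ 2 = 1 := by
  simp only [workloadDir, div_pow, mul_pow]
  rw [← Finset.sum_div, ← D.σBar_sq, div_self (pow_pos D.σBar_pos 2).ne']

/-- Since `θ_i σ_i = σ̄ u_i`, the workload is `σ̄` times the component along the unit vector `u`,
and the swap made that component equal to `x 0`. -/
theorem θ_dotProduct_gaussianSwap (x : Fin (I + 1) → ℝ) :
    D.θ ⬝ᵥ gaussianSwap D.σ D.workloadDir x = D.σBar * x 0 := by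
  set S := ∑ j, D.workloadDir j * x j.succ with hS
  have h (i : Fin I) : D.θ i * D.σ i = D.σBar * D.workloadDir i := by
    rw [workloadDir, mul_div_cancel₀ _ D.σBar_pos.ne']
  calc D.θ ⬝ᵥ gaussianSwap D.σ D.workloadDir x
      = ∑ i, (D.σBar * (D.workloadDir i * x i.succ)
          + D.σBar * (x 0 - S) * D.workloadDir i ^ 2) := by
        refine Finset.sum_congr rfl fun i _ => ?_
        rw [gaussianSwap_apply, ← hS, ← mul_assoc, h]
        ring
    _ = D.σBar * x 0 := by
        rw [Finset.sum_add_distrib, ← Finset.mul_sum, ← Finset.mul_sum, D.sum_workloadDir_sq, ← hS]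
        ring

/-- From `I + 1` independent copies of a workload process, an `I`-dimensional process whose
workload is the first copy. -/
noncomputable def extendBM {Ω : Type*} (Wb : ℝ≥0 → Ω → ℝ) :
    ℝ≥0 → (Fin (I + 1) → Ω) → Fin I → ℝ :=
  fun t ω => gaussianSwap D.σ D.workloadDir (fun k => (Wb t (ω k) - D.mBar * t) / D.σBar)
    + (t : ℝ) • D.m

theorem proj_extendBM {Ω : Type*} (Wb : ℝ≥0 → Ω → ℝ) (t : ℝ≥0) (ω : Fin (I + 1) → Ω) :
    D.proj (D.extendBM Wb) t ω = Wb t (ω 0) := by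
  have hm : D.θ ⬝ᵥ D.m = D.mBar := rfl
  rw [proj, extendBM, dotProduct_add, θ_dotProduct_gaussianSwap, dotProduct_smul, hm,
    mul_div_cancel₀ _ D.σBar_pos.ne', smul_eq_mul]
  ring

/-- Increments are a fixed affine function of the increments of the copies, which transfers both
their law and their independence of the past. -/
theorem extendBM_sub {Ω : Type*} (Wb : ℝ≥0 → Ω → ℝ) (s t : ℝ≥0) (ω : Fin (I + 1) → Ω) :
    D.extendBM Wb t ω - D.extendBM Wb s ω
      = gaussianSwap D.σ D.workloadDir
          (fun k => (Wb t (ω k) - Wb s (ω k) - D.mBar * ((t : ℝ) - s)) / D.σBar)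
        + fun i => D.m i * ((t : ℝ) - s) := by
  have h : (fun k => (Wb t (ω k) - Wb s (ω k) - D.mBar * ((t : ℝ) - s)) / D.σBar)
      = (fun k => (Wb t (ω k) - D.mBar * t) / D.σBar)
        - fun k => (Wb s (ω k) - D.mBar * s) / D.σBar := by
    funext k
    simp only [Pi.sub_apply]
    ring
  have hm : (fun i => D.m i * ((t : ℝ) - s)) = (t : ℝ) • D.m - (s : ℝ) • D.m := by
    funext i
    simp only [Pi.sub_apply, Pi.smul_apply, smul_eq_mul]
    ring
  rw [h, map_sub, hm, extendBM, extendBM]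
  abel

variable {D} {Ω : Type*} {mΩ : MeasurableSpace Ω} {P : Measure Ω} [IsProbabilityMeasure P]
  {𝓕 : Filtration ℝ≥0 mΩ} {w₀ : ℝ} {Wb Yb Zb : ℝ≥0 → Ω → ℝ}

theorem adapted_extendBM (h : Adapted 𝓕 Wb) :
    Adapted (piFiltration (Fin (I + 1)) 𝓕) (D.extendBM Wb) := by
  intro t
  have hm : Measurable[piFiltration (Fin (I + 1)) 𝓕 t]
      fun (ω : Fin (I + 1) → Ω) k => (Wb t (ω k) - D.mBar * t) / D.σBar :=
    @measurable_pi_lambda _ _ _ (_) _ _ fun k =>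
      (((h t).comp_eval_piFiltration k).sub_const _).div_const _
  exact ((gaussianSwap D.σ D.workloadDir).continuous.measurable.comp hm).add_const _

theorem IsRedAdmissible.indep_extendBM (h : D.IsRedAdmissible w₀ P 𝓕 Wb Yb Zb) (s t : ℝ≥0)
    (hst : s < t) :
    Indep (MeasurableSpace.comap (fun ω => D.extendBM Wb t ω - D.extendBM Wb s ω) inferInstance)
      (piFiltration (Fin (I + 1)) 𝓕 s) (Measure.pi fun _ => P) := by
  simp only [extendBM_sub]
  exact indep_comap_pi_piFiltration (f := fun ω => Wb t ω - Wb s ω)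
    (((h.adapted_W t).mono (𝓕.le t) le_rfl).sub ((h.adapted_W s).mono (𝓕.le s) le_rfl))
    (h.indep s t hst)
    (g := fun x => gaussianSwap D.σ D.workloadDir
      (fun k => (x k - D.mBar * ((t : ℝ) - s)) / D.σBar) + fun i => D.m i * ((t : ℝ) - s))
    (by fun_prop)

theorem IsRedAdmissible.isVecBM_extendBM (h : D.IsRedAdmissible w₀ P 𝓕 Wb Yb Zb) :
    IsVecBM D.m D.σ (Measure.pi fun _ : Fin (I + 1) => P) (D.extendBM Wb) where
  zero := by
    filter_upwards [ae_all_iff.2 fun k : Fin (I + 1) => ae_eval_of_ae h.bm.zero k] with ω hω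
    have : (fun k => (Wb 0 (ω k) - D.mBar * ((0 : ℝ≥0) : ℝ)) / D.σBar) = 0 := by
      funext k
      simp [hω k]
    rw [extendBM, this, map_zero]
    simp
  cont := by
    filter_upwards [ae_all_iff.2 fun k : Fin (I + 1) => ae_eval_of_ae h.bm.cont k] with ω hω
    unfold extendBM
    fun_prop
  indep := hasIndepIncrements_of_adapted (adapted_extendBM h.adapted_W) h.indep_extendBM
  law s t hst := by
    have hσ := D.σBar_pos
    have hB : HasLaw (fun ω => (Wb t ω - Wb s ω - D.mBar * ((t : ℝ) - s)) / D.σBar)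
        (gaussianReal 0 (t - s)) P := by
      have := gaussianReal_div_const
        (gaussianReal_sub_const (h.bm.law s t hst) (D.mBar * ((t : ℝ) - s))) D.σBar
      convert! this using 2
      · simp
      · ext
        simp [hσ.ne', max_eq_left (sq_nonneg D.σBar)]
    have : SigmaFinite
        (P.map fun ω => (Wb t ω - Wb s ω - D.mBar * ((t : ℝ) - s)) / D.σBar) := by
      rw [hB.map_eq]
      infer_instance
    have hpi : HasLaw (fun (ω : Fin (I + 1) → Ω) k =>
        (Wb t (ω k) - Wb s (ω k) - D.mBar * ((t : ℝ) - s)) / D.σBar)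
        (Measure.pi fun _ => gaussianReal 0 (t - s)) (Measure.pi fun _ => P) := by
      refine ⟨?_, ?_⟩
      · refine aemeasurable_pi_lambda _ fun k => ?_
        exact hB.aemeasurable.comp_quasiMeasurePreserving
          (measurePreserving_eval (fun _ => P) k).quasiMeasurePreserving
      · rw [Measure.pi_map_pi (fun _ => hB.aemeasurable), hB.map_eq]
    have hA : HasLaw (fun x => gaussianSwap D.σ D.workloadDir x + fun i => D.m i * ((t : ℝ) - s))
        (Measure.pi fun i => gaussianReal (D.m i * ((t : ℝ) - s))
          ((D.σ i ^ 2).toNNReal * (t - s)))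
        (Measure.pi fun _ => gaussianReal 0 (t - s)) :=
      ⟨by fun_prop, map_affine_pi_gaussianReal _ _ (fun i => (D.σ i ^ 2).toNNReal) _
        (sum_sq_gaussianSwap _ _ D.sum_workloadDir_sq)⟩
    simp only [extendBM_sub]
    exact hA.comp hpi

theorem IsRedAdmissible.comp_eval (h : D.IsRedAdmissible w₀ P 𝓕 Wb Yb Zb) :
    D.IsRedAdmissible w₀ (Measure.pi fun _ : Fin (I + 1) => P) (piFiltration (Fin (I + 1)) 𝓕)
      (fun t ω => Wb t (ω 0)) (fun t ω => Yb t (ω 0)) (fun t ω => Zb t (ω 0)) where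
  bm := by
    -- Coordinate `0` is the workload of the extended motion, hence a Brownian motion on the power
    -- space.
    have := h.isVecBM_extendBM.dotProduct D.θ D.σBar_sq
    have e : (fun t ω => D.θ ⬝ᵥ D.extendBM Wb t ω) = fun t ω => Wb t (ω 0) :=
      funext fun t => funext fun ω => D.proj_extendBM Wb t ω
    rwa [e] at this
  adapted_W t := (h.adapted_W t).comp_eval_piFiltration 0
  adapted_Y t := (h.adapted_Y t).comp_eval_piFiltration 0
  adapted_Z t := (h.adapted_Z t).comp_eval_piFiltration 0
  indep s t hst := indep_comap_pi_piFiltration (f := fun ω => Wb t ω - Wb s ω)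
    (((h.adapted_W t).mono (𝓕.le t) le_rfl).sub ((h.adapted_W s).mono (𝓕.le s) le_rfl))
    (h.indep s t hst) (g := fun x => x 0) (by fun_prop)
  rcll_Y := ae_eval_of_ae h.rcll_Y 0
  rcll_Z := ae_eval_of_ae h.rcll_Z 0
  nonneg_Y := ae_eval_of_ae h.nonneg_Y 0
  nonneg_Z := ae_eval_of_ae h.nonneg_Z 0
  mono_Y := ae_eval_of_ae h.mono_Y 0
  mono_Z := ae_eval_of_ae h.mono_Z 0
  state_mem := ae_eval_of_ae h.state_mem 0

theorem redCost_comp_eval_le :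
    D.redCost w₀ (Measure.pi fun _ : Fin (I + 1) => P) (fun t ω => Wb t (ω 0))
      (fun t ω => Yb t (ω 0)) (fun t ω => Zb t (ω 0)) ≤ D.redCost w₀ P Wb Yb Zb :=
  lintegral_pi_eval_zero_le _

end BCPData

/-! ### Equality of the values. -/

namespace BCPData

variable {I : ℕ} (D : BCPData I)

variable {D} in
theorem IsAdmissible.value_le_cost {x₀ : Fin I → ℝ} {Ω : Type u} {mΩ : MeasurableSpace Ω}
    {P : Measure Ω} [hP : IsProbabilityMeasure P] {𝓕 : Filtration ℝ≥0 mΩ}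
    {W Y Z : ℝ≥0 → Ω → Fin I → ℝ} (h : D.IsAdmissible x₀ P 𝓕 W Y Z) :
    D.value.{u} x₀ ≤ D.cost x₀ P W Y Z :=
  sInf_le ⟨Ω, mΩ, P, 𝓕, W, Y, Z, hP, h, rfl⟩

variable {D} in
theorem IsRedAdmissible.redValue_le_redCost {w₀ : ℝ} {Ω : Type u} {mΩ : MeasurableSpace Ω}
    {P : Measure Ω} [hP : IsProbabilityMeasure P] {𝓕 : Filtration ℝ≥0 mΩ}
    {W Y Z : ℝ≥0 → Ω → ℝ} (h : D.IsRedAdmissible w₀ P 𝓕 W Y Z) :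
    D.redValue.{u} w₀ ≤ D.redCost w₀ P W Y Z :=
  sInf_le ⟨Ω, mΩ, P, 𝓕, W, Y, Z, hP, h, rfl⟩

theorem redValue_le_value (x₀ : Fin I → ℝ) : D.redValue.{u} (D.θ ⬝ᵥ x₀) ≤ D.value.{u} x₀ := by
  refine le_sInf ?_
  rintro c ⟨Ω, mΩ, P, 𝓕, W, Y, Z, hP, h, rfl⟩
  exact h.toIsRelaxedControl.isRedAdmissible_proj.redValue_le_redCost.trans
    h.toIsRelaxedControl.redCost_proj_le

theorem value_le_redValue (x₀ : Fin I → ℝ) : D.value.{u} x₀ ≤ D.redValue.{u} (D.θ ⬝ᵥ x₀) := by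
  refine le_sInf ?_
  rintro c ⟨Ω, mΩ, P, 𝓕, Wb, Yb, Zb, hP, h, rfl⟩
  refine ENNReal.le_of_forall_pos_le_add fun δ hδ _ => ?_
  -- With `ε = δ α`, the discounted loss `ε / α` is exactly `δ`.
  have hε : 0 < (δ : ℝ) * D.α := mul_pos hδ D.α_pos
  obtain ⟨γ, hγc, hγ⟩ := D.exists_continuous_selection hε
  obtain ⟨i, hi⟩ := D.exists_isCheapestClass
  -- The lift takes place on the power space, where a Brownian motion with workload `W̄` exists.
  have h' := h.comp_eval
  have hrel := h'.isRelaxedControl_lift (i := i) hγc.measurable (fun w hw => (hγ w hw).1)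
    h.isVecBM_extendBM (adapted_extendBM h.adapted_W)
    (ae_of_all _ fun ω t => D.proj_extendBM Wb t ω) h.indep_extendBM
  have hadm : D.IsAdmissible x₀ _ _ _ _ _ :=
    ⟨hrel, (rcll_liftY_iff h'.rcll_Z hrel.bm.cont).2 (h'.rcll_comp_redState hγc.continuousOn)⟩
  refine hadm.value_le_cost.trans ?_
  refine (h'.cost_lift_le (fun w hw => (hγ w hw).2) hi).trans ?_
  rw [mul_div_cancel_right₀ _ D.α_pos.ne', ENNReal.ofReal_coe_nnreal]
  gcongr
  exact redCost_comp_eval_le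

end BCPData

theorem proposition1 {I : ℕ} (D : BCPData I) (x₀ : Fin I → ℝ) (hx₀ : x₀ ∈ D.dom) :
    -- (i) projection
    (∀ (Ω : Type u) (mΩ : MeasurableSpace Ω) (P : Measure Ω) (𝓕 : Filtration ℝ≥0 mΩ)
      (W Y Z : ℝ≥0 → Ω → Fin I → ℝ), IsProbabilityMeasure P →
      D.IsAdmissible x₀ P 𝓕 W Y Z →
        D.IsRedAdmissible (D.θ ⬝ᵥ x₀) P 𝓕 (D.proj W) (D.proj Y) (D.proj Z) ∧
        BCPData.redState (D.θ ⬝ᵥ x₀) (D.proj W) (D.proj Y) (D.proj Z) =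
          D.proj (BCPData.state x₀ W Y Z) ∧
        D.redCost (D.θ ⬝ᵥ x₀) P (D.proj W) (D.proj Y) (D.proj Z) ≤ D.cost x₀ P W Y Z) ∧
    -- (ii) lifting
    (∀ (γ : ℝ → Fin I → ℝ) (istar : Fin I), D.IsMinimizingCurve γ → D.IsCheapestClass istar →
      ∀ (Ω : Type u) (mΩ : MeasurableSpace Ω) (P : Measure Ω) (𝓕 : Filtration ℝ≥0 mΩ)
        (Wb Yb Zb : ℝ≥0 → Ω → ℝ) (W : ℝ≥0 → Ω → Fin I → ℝ), IsProbabilityMeasure P →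
        D.IsRedAdmissible (D.θ ⬝ᵥ x₀) P 𝓕 Wb Yb Zb →
        IsVecBM D.m D.σ P W →
        Adapted 𝓕 W →
        (∀ᵐ ω ∂P, ∀ t, D.proj W t ω = Wb t ω) →
        (∀ s t : ℝ≥0, s < t →
          Indep (MeasurableSpace.comap (fun ω => W t ω - W s ω) inferInstance) (𝓕 s) P) →
        ∀ (Xb : ℝ≥0 → Ω → ℝ) (Y Z : ℝ≥0 → Ω → Fin I → ℝ),
          Xb = BCPData.redState (D.θ ⬝ᵥ x₀) Wb Yb Zb →
          Z = D.liftZ istar Zb →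
          Y = D.liftY γ istar x₀ W Xb Zb →
            D.IsRelaxedControl x₀ P 𝓕 W Y Z ∧
            (D.IsAdmissible x₀ P 𝓕 W Y Z ↔ ∀ᵐ ω ∂P, IsRCLL fun t => γ (Xb t ω)) ∧
            (ContinuousOn γ (Icc 0 D.xMax) → D.IsAdmissible x₀ P 𝓕 W Y Z) ∧
            D.cost x₀ P W Y Z = D.redCost (D.θ ⬝ᵥ x₀) P Wb Yb Zb) ∧
    -- (iii) equality of the values
    D.value.{u} x₀ = D.redValue.{u} (D.θ ⬝ᵥ x₀) := by
  refine ⟨?_, ?_, le_antisymm (D.value_le_redValue x₀) (D.redValue_le_value x₀)⟩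
  · intro Ω mΩ P 𝓕 W Y Z _ h
    exact ⟨h.toIsRelaxedControl.isRedAdmissible_proj, D.redState_proj x₀ W Y Z,
      h.toIsRelaxedControl.redCost_proj_le⟩
  · rintro γ i hγ hi Ω mΩ P 𝓕 Wb Yb Zb W _ h hbm hW hWb hind _ _ _ rfl rfl rfl
    have hrel := h.isRelaxedControl_lift (i := i) hγ.measurable hγ.mem hbm hW hWb hind
    have hiff := BCPData.rcll_liftY_iff (D := D) (x₀ := x₀) (γ := γ) (i := i) h.rcll_Z hbm.cont
      (Xb := BCPData.redState (D.θ ⬝ᵥ x₀) Wb Yb Zb)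
    exact ⟨hrel, ⟨fun ha => hiff.1 ha.rcll_Y, fun hr => ⟨hrel, hiff.2 hr⟩⟩,
      fun hc => ⟨hrel, hiff.2 (h.rcll_comp_redState hc)⟩, h.cost_lift_eq hγ hi⟩
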